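/- Let $(M_0,P_0)$ be a germ of nonsingular complex analytic surface. Let $\pi:(M,K)\to(M_0,P_0)$ be the composition of a cuspidal sequence of blowing-ups with last exceptional divisor $E$. This means that each center after the first lies on the last exceptional divisor created, and that once a center is a corner of the exceptional divisor all the later ones are corners too. Let $(x,y)$ be local coordinates at $P_0$ adapted to the sequence: the strict transforms of $y=0$ pass through all the centers that are free points. Let $(n,m)$ be the Puiseux pair of the sequence, defined by induction on its length: it is $(1,1)$ for one blowing-up; otherwise, if $(n_1,m_1)$ is the pair of the sequence of the remaining blowing-ups, seen as a sequence over the second center, then $(n,m)=(n_1,n_1+m_1)$ if the third center exists and is a free point, and $(n,m)=(m_1,n_1+m_1)$ otherwise. Assume $n\ge 2$. Let $\mathcal C$ be an $E$-cusp: a branch at $P_0$ whose strict transform by $\pi$ is nonsingular and cuts $E$ transversely at a free point (a point of $E$ that is not a corner of the exceptional divisor). Let $\phi(t)$ be a reduced parametrization of $\mathcal C$. For a germ of holomorphic $1$-form $\omega$ at $P_0$, the differential value $\nu_{\mathcal C}(\omega)\in\mathbb Z_{\ge 0}\cup\{\infty\}$ is the order in $t$ of $a(t)$, where $\phi^*\omega=a(t)\,dt/t$.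 The divisorial order $\nu_E(\omega)$ is the largest $\ell$ such that $u^{-\ell}\pi^*\omega$ is a logarithmic $1$-form along $E$ at a free point of $E$, where $u=0$ is a reduced local equation of $E$ (it does not depend on the free point). Put $\Gamma=n\mathbb Z_{\ge 0}+m\mathbb Z_{\ge 0}$ and $\Lambda=\{\nu_{\mathcal C}(\omega)\}\setminus\{\infty\}$, where $\omega$ runs over all germs of holomorphic $1$-forms at $P_0$. Let $\lambda_{-1}<\lambda_0<\lambda_1<\dots<\lambda_s$ (one has $\lambda_{-1}=n$, $\lambda_0=m$) be the basis of $\Lambda$, that is, $\Lambda=\bigcup_{k=-1}^{s}(\lambda_k+\Gamma)$ and $\lambda_k\notin\Lambda_{k-1}$ for $0\le k\le s$, where $\Lambda_k=\bigcup_{\ell=-1}^{k}(\lambda_\ell+\Gamma)$. Define $$u_i=\min\big(\Lambda_{i-2}\cap(\lambda_{i-1}+\Gamma)\big)\quad(1\le i\le s+1),$$ $$t_{-1}=n,\qquad t_0=m,\qquad t_i=t_{i-1}+u_i-\lambda_{i-1}\quad(1\le i\le s+1).$$ Let $\omega_{-1}=dx,\ \omega_0=dy,\ \omega_1,\dots,\omega_s;\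 \omega_{s+1}$ be an extended standard basis of $\mathcal C$: holomorphic $1$-forms with $\nu_{\mathcal C}(\omega_k)=\lambda_k$ for $-1\le k\le s$, $\nu_E(\omega_{s+1})=t_{s+1}$ and $\nu_{\mathcal C}(\omega_{s+1})=\infty$. Then for all indices $0\le j\le i\le s$ there are germs of holomorphic functions $f^{ij}_{-1},\dots,f^{ij}_{j}$ at $P_0$ such that $$\omega_{i+1}=\sum_{\ell=-1}^{j}f^{ij}_\ell\,\omega_\ell$$ and such that, with $v_{ij}=t_{i+1}-t_j+\lambda_j$, one has $\nu_{\mathcal C}(f^{ij}_\ell\omega_\ell)\ge v_{ij}$ for all $-1\le\ell\le j$, $\nu_{\mathcal C}(f^{ij}_j\omega_j)=v_{ij}$, and there is exactly one index $-1\le k\le j-1$ with $\nu_{\mathcal C}(f^{ij}_k\omega_k)=v_{ij}$. -/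

import Mathlib

noncomputable section

namespace Delorme

open MvPowerSeries

/-! ### Convergent power series and germs of holomorphic 1-forms -/

/-- A complex power series in the variables `σ` is convergent if it converges absolutely on some
polydisc of positive radius. As `PowerSeries ℂ` is `MvPowerSeries Unit ℂ`, this also covers series
in one variable. -/
def IsConvergent {σ : Type} (f : MvPowerSeries σ ℂ) : Prop :=
  ∃ r : ℝ, 0 < r ∧ Summable fun d : σ →₀ ℕ => ‖coeff d f‖ * r ^ d.degree

theorem summable_of_le {σ : Type} {f : MvPowerSeries σ ℂ} {r r' : ℝ} (h0 : 0 < r') (h : r' ≤ r)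
    (hf : Summable fun d : σ →₀ ℕ => ‖coeff d f‖ * r ^ d.degree) :
    Summable fun d : σ →₀ ℕ => ‖coeff d f‖ * r' ^ d.degree :=
  hf.of_nonneg_of_le (fun _ => by positivity) fun _ => by gcongr

theorem IsConvergent.add {σ : Type} {f g : MvPowerSeries σ ℂ} (hf : IsConvergent f)
    (hg : IsConvergent g) : IsConvergent (f + g) := by
  obtain ⟨r, hr, hf⟩ := hf
  obtain ⟨q, hq, hg⟩ := hg
  have hm : 0 < min r q := lt_min hr hq
  refine ⟨min r q, hm, ((summable_of_le hm (min_le_left _ _) hf).add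
    (summable_of_le hm (min_le_right _ _) hg)).of_nonneg_of_le
      (fun _ => by positivity) fun d => ?_⟩
  rw [map_add, ← add_mul]
  gcongr
  exact norm_add_le _ _

theorem norm_coeff_mul_le {σ : Type} [DecidableEq σ] (f g : MvPowerSeries σ ℂ) {r : ℝ}
    (hr : 0 < r) (d : σ →₀ ℕ) :
    ‖coeff d (f * g)‖ * r ^ d.degree ≤ ∑ p ∈ Finset.HasAntidiagonal.antidiagonal d,
      (‖coeff p.1 f‖ * r ^ p.1.degree) * (‖coeff p.2 g‖ * r ^ p.2.degree) := by
  rw [coeff_mul]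
  refine (mul_le_mul_of_nonneg_right (norm_sum_le _ _) (pow_pos hr _).le).trans ?_
  rw [Finset.sum_mul]
  refine Finset.sum_le_sum fun p hp => le_of_eq ?_
  have hd : d.degree = p.1.degree + p.2.degree := by
    rw [← Finset.HasAntidiagonal.mem_antidiagonal.1 hp, map_add]
  rw [hd, pow_add, norm_mul]
  ring

theorem IsConvergent.mul {σ : Type} {f g : MvPowerSeries σ ℂ} (hf : IsConvergent f)
    (hg : IsConvergent g) : IsConvergent (f * g) := by
  classical
  obtain ⟨r, hr, hf⟩ := hf
  obtain ⟨q, hq, hg⟩ := hg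
  have hm : 0 < min r q := lt_min hr hq
  have h1 := summable_of_le hm (min_le_left r q) hf
  have h2 := summable_of_le hm (min_le_right r q) hg
  have h3 := summable_sum_mul_antidiagonal_of_summable_mul
    (f := fun d : σ →₀ ℕ => ‖coeff d f‖ * min r q ^ d.degree)
    (g := fun d : σ →₀ ℕ => ‖coeff d g‖ * min r q ^ d.degree)
    (h1.mul_of_nonneg h2 (fun d => mul_nonneg (norm_nonneg _) (pow_pos hm _).le)
      (fun d => mul_nonneg (norm_nonneg _) (pow_pos hm _).le))
  exact ⟨min r q, hm, h3.of_nonneg_of_le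
    (fun d => mul_nonneg (norm_nonneg _) (pow_pos hm _).le)
    fun d => norm_coeff_mul_le f g hm d⟩

theorem IsConvergent.const {σ : Type} (c : ℂ) : IsConvergent (C c : MvPowerSeries σ ℂ) := by
  classical
  refine ⟨1, one_pos, summable_of_ne_finset_zero (s := {0}) fun d hd => ?_⟩
  rw [coeff_C, if_neg (by simpa using hd)]
  simp

/-- The ring `ℂ{x, y}` of germs of holomorphic functions at the origin of the plane, in the fixed
adapted coordinates `x = X 0`, `y = X 1`. -/
def Germ : Subalgebra ℂ (MvPowerSeries (Fin 2) ℂ) where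
  carrier := {f | IsConvergent f}
  mul_mem' := IsConvergent.mul
  add_mem' := IsConvergent.add
  algebraMap_mem' c := IsConvergent.const c

/-- Germs of holomorphic 1-forms `a dx + b dy`, as the free `ℂ{x, y}`-module of pairs `(a, b)`. -/
abbrev OneForm : Type := Germ × Germ

/-- The form `dx`. -/
def dx : OneForm := (1, 0)

/-- The form `dy`. -/
def dy : OneForm := (0, 1)

/-! ### Cuspidal sequences of blowing-ups in adapted coordinates -/

/-- A (germ of a) map between planes, given by its two coordinate series. -/
abbrev PlaneMap : Type := Fin 2 → MvPowerSeries (Fin 2) ℂ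

/-- The composition `F ∘ G`. -/
def PlaneMap.comp (F G : PlaneMap) : PlaneMap := fun i => subst G (F i)

/-- A cuspidal sequence of blowing-ups over the plane germ, in adapted coordinates `(x, y)`, that
is, such that `y = 0` has maximal contact with it. Except for a single blowing-up, the second
center `P₁` is the point of the first exceptional divisor `E₁` on the strict transform of `y = 0`,
and the remaining blowing-ups form a cuspidal sequence over `P₁` which has maximal contact either
with the strict transform of `y = 0` (`free`: the next center, if any, is a free point) or with
`E₁` (`corner`: the next center, if any, is a corner point, and so are all the later ones). -/
inductive CuspidalSeq : Type
  | single : CuspidalSeq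
  | free : CuspidalSeq → CuspidalSeq
  | corner : CuspidalSeq → CuspidalSeq

/-- The Puiseux pair `(n, m)` of a cuspidal sequence. -/
def CuspidalSeq.puiseux : CuspidalSeq → ℕ × ℕ
  | single => (1, 1)
  | free S => (S.puiseux.1, S.puiseux.2 + S.puiseux.1)
  | corner S => (S.puiseux.2, S.puiseux.1 + S.puiseux.2)

/-- The first entry `n` of the Puiseux pair. -/
def CuspidalSeq.n (S : CuspidalSeq) : ℕ := S.puiseux.1

/-- The second entry `m` of the Puiseux pair. -/
def CuspidalSeq.m (S : CuspidalSeq) : ℕ := S.puiseux.2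

/-- The composition `π` of all the blowing-ups of the sequence, written in local coordinates
`(u, v) = (X 0, X 1)` centered at the point of parameter `c` of the last divisor `E = (u = 0)`.
The adapted coordinates `(x₁, y₁)` at `P₁` are given by `x = x₁, y = x₁ y₁` in the case `free`
(`E₁` is `x₁ = 0` and the strict transform of `y = 0` is `y₁ = 0`) and by `x = y₁, y = x₁ y₁` in
the case `corner` (`E₁` is `y₁ = 0`). The last blowing-up is `x' = u, y' = u (v + c)`.
When `n ≥ 2`, the last center is the corner point `x' = y' = 0` of the divisor `x' y' = 0`, hence
the free points of `E` are exactly those with parameter `c ∈ ℂ`, `c ≠ 0`. -/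
def CuspidalSeq.chart (c : ℂ) : CuspidalSeq → PlaneMap
  | single => ![X 0, X 0 * (X 1 + C c)]
  | free S => PlaneMap.comp ![X 0, X 0 * X 1] (S.chart c)
  | corner S => PlaneMap.comp ![X 1, X 0 * X 1] (S.chart c)

/-- The pull-back of a 1-form by a map `F`: the coefficients of `du` and `dv` in `F^* ω`. -/
def pullback (F : PlaneMap) (ω : OneForm) :
    MvPowerSeries (Fin 2) ℂ × MvPowerSeries (Fin 2) ℂ :=
  (subst F (ω.1 : MvPowerSeries (Fin 2) ℂ) * pderiv ℂ 0 (F 0) +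
      subst F (ω.2 : MvPowerSeries (Fin 2) ℂ) * pderiv ℂ 0 (F 1),
    subst F (ω.1 : MvPowerSeries (Fin 2) ℂ) * pderiv ℂ 1 (F 0) +
      subst F (ω.2 : MvPowerSeries (Fin 2) ℂ) * pderiv ℂ 1 (F 1))

/-- The divisorial order `ν_E(ω)`: the largest `ℓ` such that `u^{-ℓ} π^* ω` is a logarithmic form
along `E = (u = 0)`, where `π^* ω = A du + B dv = (u A) du/u + B dv`. It does not depend on the
free point of `E` where it is computed; we take the one of parameter `1`. -/
def nuE (S : CuspidalSeq) (ω : OneForm) : ℕ∞ :=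
  min (emultiplicity (X 0 : MvPowerSeries (Fin 2) ℂ) (X 0 * (pullback (S.chart 1) ω).1))
    (emultiplicity (X 0 : MvPowerSeries (Fin 2) ℂ) (pullback (S.chart 1) ω).2)

/-! ### Cusps and differential values -/

/-- An `E`-cusp, for the last divisor `E` of a cuspidal sequence with `n ≥ 2`: a branch whose strict
transform is nonsingular and cuts `E` transversely at a free point. It is given by the parameter
`point` of that free point and by a parametrization `(u, v) = strict(t)` of the strict transform,
which is regular and transverse to `E = (u = 0)`. -/
structure ECusp where
  /-- the cuspidal sequence -/
  S : CuspidalSeq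
  two_le_n : 2 ≤ S.n
  /-- the parameter of the free point of `E` on the strict transform -/
  point : ℂ
  point_ne_zero : point ≠ 0
  /-- the parametrization of the strict transform -/
  strict : Fin 2 → PowerSeries ℂ
  convergent : ∀ i, IsConvergent (strict i)
  centered : ∀ i, PowerSeries.constantCoeff (strict i) = 0
  transverse : PowerSeries.coeff 1 (strict 0) ≠ 0

namespace ECusp

variable (K : ECusp)

/-- The parametrization `φ(t) = (x(t), y(t))` of the cusp, image of the strict transform by `π`. -/
def param : Fin 2 → PowerSeries ℂ := fun i => subst K.strict (K.S.chart K.point i)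

/-- The differential value `ν_C(ω)`: the order in `t` of `a(t)`, where `φ^* ω = a(t) dt/t`. -/
def nu (ω : OneForm) : ℕ∞ :=
  (PowerSeries.X *
    ((subst K.param (ω.1 : MvPowerSeries (Fin 2) ℂ) : PowerSeries ℂ) *
        PowerSeries.derivative ℂ (K.param 0) +
      (subst K.param (ω.2 : MvPowerSeries (Fin 2) ℂ) : PowerSeries ℂ) *
        PowerSeries.derivative ℂ (K.param 1))).order

/-- The semimodule `Λ` of differential values of the cusp. -/
def semimodule : Set ℕ := {p | ∃ ω : OneForm, K.nu ω = p}

end ECusp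

/-! ### Semimodules over `Γ = ⟨n, m⟩`

All the families indexed by `-1, 0, 1, …` are shifted by one: `lam k` is `λ_{k-1}`. The same holds
for the critical orders `t` and the forms `ω`. The axes `u_i` are not shifted. -/

/-- The translate `p + Γ` of the semigroup `Γ` generated by `n` and `m`. -/
def translate (n m p : ℕ) : Set ℕ := {q | ∃ a b : ℕ, q = p + (a * n + b * m)}

/-- The union of the sets `λ + Γ` for the first `k` elements `λ` of the list `lam`; in unshifted
notation this is `Λ_{k-2} = ⋃_{-1 ≤ j ≤ k-2} (λ_j + Γ)`. -/
def generated (n m : ℕ) (lam : ℕ → ℕ) (k : ℕ) : Set ℕ := {q | ∃ l < k, q ∈ translate n m (lam l)}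

/-- `λ_{-1}, λ_0, …, λ_s` is the basis of the semimodule `Λ`: it is strictly increasing, no element
lies in the semimodule generated by the previous ones, and it generates `Λ`. -/
structure IsBasis (n m : ℕ) (Λ : Set ℕ) (s : ℕ) (lam : ℕ → ℕ) : Prop where
  increasing : ∀ k l, k < l → l ≤ s + 1 → lam k < lam l
  independent : ∀ k, k ≤ s + 1 → lam k ∉ generated n m lam k
  generates : Λ = generated n m lam (s + 2)

/-- The axis `u_i = min (Λ_{i-2} ∩ (λ_{i-1} + Γ))` for `1 ≤ i ≤ s + 1` (and `u_0 = λ_{-1}`). -/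
def axis (n m : ℕ) (lam : ℕ → ℕ) : ℕ → ℕ
  | 0 => lam 0
  | i + 1 => sInf (generated n m lam (i + 1) ∩ translate n m (lam (i + 1)))

/-- The critical divisorial orders, shifted: `t_{-1} = n`, `t_0 = m` and
`t_i = t_{i-1} + (u_i - λ_{i-1})`, where `u_i ≥ λ_{i-1}`. -/
def crit (n m : ℕ) (lam : ℕ → ℕ) : ℕ → ℕ
  | 0 => n
  | 1 => m
  | k + 2 => crit n m lam (k + 1) + (axis n m lam (k + 1) - lam (k + 1))

/-- `ω_{-1} = dx, ω_0 = dy, ω_1, …, ω_s; ω_{s+1}` (shifted by one) is an extended standard basis of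
the cusp with basis `λ_{-1}, …, λ_s` of its semimodule of differential values: `ν_C(ω_k) = λ_k` for
`-1 ≤ k ≤ s`, and `ω_{s+1}` is dicritically adjusted, that is, `ν_E(ω_{s+1}) = t_{s+1}` and
`ν_C(ω_{s+1}) = ∞`. -/
structure IsExtendedStandardBasis (K : ECusp) (s : ℕ) (lam : ℕ → ℕ) (ω : ℕ → OneForm) : Prop where
  basis : IsBasis K.S.n K.S.m K.semimodule s lam
  first : ω 0 = dx
  second : ω 1 = dy
  value : ∀ k, k ≤ s + 1 → K.nu (ω k) = lam k
  order_last : nuE K.S (ω (s + 2)) = crit K.S.n K.S.m lam (s + 2)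
  value_last : K.nu (ω (s + 2)) = ⊤

/-- The number `v_{ij} = t_{i+1} - t_j + λ_j`, for `0 ≤ j ≤ i` (`t` is non-decreasing). -/
def vbound (n m : ℕ) (lam : ℕ → ℕ) (i j : ℕ) : ℕ :=
  crit n m lam (i + 2) - crit n m lam (j + 1) + lam (j + 1)

end Delorme

end

noncomputable section

namespace Delorme

/-! ### Combinatorics of semimodules over `⟨n, m⟩` -/

/-! Notation, with the shifted indices of the code: λ_k = `lam k`, t_k = `crit n m lam k`, u_k =
`axis n m lam k`, G_k = `generated n m lam k`; thus t_{k+1} = t_k + u_k - λ_k.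

The proof compares ν_C with the weighted order `wOrder`, where x, dx have weight n and y, dy have
weight m. It bounds ν_C and ν_E from below, and equals ν_E when ν_E < nm (`wOrder_eq_of_nuE`). Below
nm each weight belongs to at most one monomial, so a form of weighted order p < nm with ν_C > p has
its part of weight p proportional to x^a y^b (m dx/x - n dy/y) (`exists_resonant`). Hence two such
forms of equal weighted order combine to raise that order (`exists_wOrder_sub_lt`), just as two
forms of equal value combine to raise the value (`exists_nu_sub_lt`).

Playing the two eliminations against each other gives, by induction on k (`increasingUpTo`): u_l <
λ_{l+1} for 1 ≤ l < k; ω_k has weighted order t_k; and a form whose value is finite and outside G_k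
has weighted order t_k + γ with γ in Γ, and value at least λ_k + γ. The arithmetic input is `Notch`,
which describes the semimodule near its last generator and shows that no gap lies beyond the second
inner corner.

For the decomposition, cancel the terms of value u_k between monomial multiples of ω_k and of some
earlier ω_l. The result has weighted order t_{k+1} and value above u_k, like ω_{k+1} itself.
Subtracting a constant multiple of it from ω_{k+1} leaves a form of larger weighted order, which
`exists_sum_of_lt` writes through ω_0, …, ω_k with every term of value above u_k. So exactly two
terms have value u_k: this is the case j = i. Smaller j follow by substituting one decomposition
into another. -/

theorem mem_translate {n m p a b : ℕ} : p + (a * n + b * m) ∈ translate n m p := ⟨a, b, rfl⟩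

theorem self_mem_translate {n m p : ℕ} : p ∈ translate n m p := ⟨0, 0, by simp⟩

theorem le_of_mem_translate {n m p q : ℕ} (h : q ∈ translate n m p) : p ≤ q := by
  obtain ⟨a, b, rfl⟩ := h; omega

theorem translate_trans {n m p q r : ℕ} (h : q ∈ translate n m p) (h' : r ∈ translate n m q) :
    r ∈ translate n m p := by
  obtain ⟨a, b, rfl⟩ := h
  obtain ⟨a', b', rfl⟩ := h'
  exact ⟨a + a', b + b', by ring⟩

theorem translate_swap (n m p : ℕ) : translate n m p = translate m n p := by
  ext q
  constructor <;> rintro ⟨a, b, rfl⟩ <;> exact ⟨b, a, by ring⟩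

theorem mem_generated_of_translate {n m : ℕ} {lam : ℕ → ℕ} {k q r : ℕ}
    (h : q ∈ generated n m lam k) (h' : r ∈ translate n m q) : r ∈ generated n m lam k := by
  obtain ⟨l, hl, h⟩ := h
  exact ⟨l, hl, translate_trans h h'⟩

theorem generated_mono {n m : ℕ} {lam : ℕ → ℕ} {k k' : ℕ} (h : k ≤ k') :
    generated n m lam k ⊆ generated n m lam k' :=
  fun _ ⟨l, hl, h'⟩ => ⟨l, hl.trans_le h, h'⟩

theorem mem_generated_succ {n m : ℕ} {lam : ℕ → ℕ} {k q : ℕ} :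
    q ∈ generated n m lam (k + 1) ↔ q ∈ generated n m lam k ∨ q ∈ translate n m (lam k) := by
  constructor
  · rintro ⟨l, hl, h⟩
    rcases Nat.lt_succ_iff_lt_or_eq.1 hl with h1 | rfl
    · exact Or.inl ⟨l, h1, h⟩
    · exact Or.inr h
  · rintro (h | h)
    · exact generated_mono (Nat.le_succ k) h
    · exact ⟨k, Nat.lt_succ_self k, h⟩

theorem eq_zero_of_mul_eq_mul {n m c d : ℕ} (h : n.Coprime m) (hd : d < n)
    (e : c * n = d * m) : d = 0 := by
  have : n ∣ d := h.dvd_of_dvd_mul_right (Dvd.intro_left c e)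
  exact Nat.eq_zero_of_dvd_of_lt this hd

/-- The staircase of the semimodule `G ∪ (l + Γ)` next to its last generator `l`: the numbers `U`
and `V` are the weights of the two inner corners adjacent to `l`, all the gaps above `U` lie below
the corner `V`, and `V - n - m` is such a gap. -/
structure Notch (n m : ℕ) (G : Set ℕ) (l U V : ℕ) : Prop where
  mem : U ∈ G
  mem_translate : U ∈ translate n m l
  lt : U < V
  le : V ≤ n * m
  inter : ∀ q ∈ G, q ∈ translate n m l → q ∈ translate n m U ∨ V ≤ q
  gap : ∀ p, p ∉ G → p ∉ translate n m l → U < p →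
    ∃ a b, p + ((a + 1) * n + (b + 1) * m) = V
  corner : ∀ q, q ∈ G ∨ q ∈ translate n m l → q + (n + m) ≠ V

theorem Notch.sInf_eq {n m : ℕ} {G : Set ℕ} {l U V : ℕ} (h : Notch n m G l U V) :
    sInf (G ∩ translate n m l) = U := by
  refine le_antisymm (Nat.sInf_le ⟨h.mem, h.mem_translate⟩) ?_
  refine le_csInf ⟨U, h.mem, h.mem_translate⟩ ?_
  rintro q ⟨h1, h2⟩
  rcases h.inter q h1 h2 with h3 | h3
  · exact le_of_mem_translate h3
  · exact h.lt.le.trans h3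

theorem Notch.swap {n m : ℕ} {G : Set ℕ} {l U V : ℕ} (h : Notch n m G l U V) :
    Notch m n G l U V where
  mem := h.mem
  mem_translate := by rw [translate_swap]; exact h.mem_translate
  lt := h.lt
  le := by rw [mul_comm]; exact h.le
  inter q h1 h2 := by
    rw [translate_swap m n] at *
    exact h.inter q h1 h2
  gap p h1 h2 h3 := by
    rw [translate_swap] at h2
    obtain ⟨a, b, e⟩ := h.gap p h1 h2 h3
    exact ⟨b, a, by rw [← e]; ring⟩
  corner q h1 := by
    rw [translate_swap] at h1
    have := h.corner q h1
    omega

/-- A new generator l' above U is a gap V - (c+1)n - (d+1)m. Moving from it in the direction n or m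
until the old semimodule is met gives the two new inner corners; here the n-direction gives the
smaller one. -/
theorem notch_step_aux {n m : ℕ} (hnm : n.Coprime m) {G G' : Set ℕ} {l U V : ℕ}
    (h : Notch n m G l U V) (hG' : ∀ q, q ∈ G' ↔ q ∈ G ∨ q ∈ translate n m l)
    (hcl : ∀ q ∈ G', ∀ r ∈ translate n m q, r ∈ G') {l' c d : ℕ} (hU : U < l')
    (hV : l' + ((c + 1) * n + (d + 1) * m) = V) (hlt : (c + 1) * n < (d + 1) * m) :
    Notch n m G' l' (l' + (c + 1) * n) (l' + (d + 1) * m) := by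
  have hn : 0 < n := by
    rcases Nat.eq_zero_or_pos n with rfl | h0
    · have := h.le; have := h.lt; omega
    · exact h0
  have hm : 0 < m := by
    rcases Nat.eq_zero_or_pos m with rfl | h0
    · have := h.le; have := h.lt; omega
    · exact h0
  have hdn : d + 1 < n := by
    have : (d + 1) * m < n * m := by have := h.le; nlinarith
    exact Nat.lt_of_mul_lt_mul_right this
  have hcm : c + 1 < m := by
    have : (c + 1) * n < m * n := by have := h.le; nlinarith
    exact Nat.lt_of_mul_lt_mul_right this
  have gap' : ∀ p, p ∉ G' → U < p → ∃ a b, p + ((a + 1) * n + (b + 1) * m) = V := by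
    intro p hp hUp
    rw [hG', not_or] at hp
    exact h.gap p hp.1 hp.2 hUp
  have mem1 : l' + (c + 1) * n ∈ G' := by
    by_contra hc
    obtain ⟨a, b, e⟩ := gap' _ hc (by omega)
    have e1 : (a + 1) * n + (b + 1) * m = (d + 1) * m := by omega
    have hb : b ≤ d := by
      by_contra hb
      have : (d + 1) * m ≤ (b + 1) * m := by gcongr; omega
      have : 0 < (a + 1) * n := by positivity
      omega
    obtain ⟨t, rfl⟩ := Nat.exists_eq_add_of_le hb
    have e2 : (a + 1) * n = t * m := by nlinarith
    have := eq_zero_of_mul_eq_mul hnm (by omega) e2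
    subst this
    have : 0 < (a + 1) * n := by positivity
    omega
  -- Inside the open rectangle of sides c+1, d+1 nothing is in G', since otherwise V - n - m would
  -- be, against `corner`.
  have key : ∀ a b, l' + (a * n + b * m) ∈ G' → c + 1 ≤ a ∨ d + 1 ≤ b := by
    intro a b hab
    by_contra hc
    rw [not_or, not_le, not_le] at hc
    obtain ⟨t, ht⟩ := Nat.exists_eq_add_of_le (Nat.lt_succ_iff.1 hc.1)
    obtain ⟨r, hr⟩ := Nat.exists_eq_add_of_le (Nat.lt_succ_iff.1 hc.2)
    refine h.corner (l' + (a * n + b * m) + (t * n + r * m))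
        ((hG' _).1 (hcl _ hab _ ⟨t, r, rfl⟩)) ?_
    rw [← hV, ht, hr]; ring
  refine ⟨mem1, ⟨c + 1, 0, by ring⟩, by omega, by have := h.le; omega, ?_, ?_, ?_⟩
  · rintro q hq ⟨a, b, rfl⟩
    rcases key a b hq with h1 | h1
    · obtain ⟨t, rfl⟩ := Nat.exists_eq_add_of_le h1
      exact Or.inl ⟨t, b, by ring⟩
    · right
      have : (d + 1) * m ≤ b * m := by gcongr
      omega
  · intro p hp hpl hUp
    obtain ⟨a, b, e⟩ := gap' p hp (by omega)
    by_cases hac : c < a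
    · obtain ⟨t, rfl⟩ := Nat.exists_eq_add_of_lt hac
      exact ⟨t, b, by nlinarith⟩
    · exfalso
      obtain ⟨t, ht⟩ := Nat.exists_eq_add_of_le (not_lt.1 hac)
      by_cases hbd : d < b
      · have : (d + 1) * m ≤ b * m := by gcongr; omega
        have h3 : 0 < (a + 1) * n := by positivity
        have h4 : (b + 1) * m = b * m + m := by ring
        omega
      · obtain ⟨r, hr⟩ := Nat.exists_eq_add_of_le (not_lt.1 hbd)
        exact hpl ⟨t, r, by subst ht hr; nlinarith⟩
  · rintro q (hq | ⟨a, b, rfl⟩) e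
    · refine h.corner (q + ((c + 1) * n + 0 * m)) ((hG' _).1 (hcl _ hq _ ⟨c + 1, 0, rfl⟩)) ?_
      omega
    · have e1 : (a + 1) * n + (b + 1) * m = (d + 1) * m := by nlinarith
      have hb : b ≤ d := by
        by_contra hb
        have : (d + 1) * m ≤ (b + 1) * m := by gcongr; omega
        have : 0 < (a + 1) * n := by positivity
        omega
      obtain ⟨t, rfl⟩ := Nat.exists_eq_add_of_le hb
      have e2 : (a + 1) * n = t * m := by nlinarith
      have := eq_zero_of_mul_eq_mul hnm (by omega) e2
      subst this
      have : 0 < (a + 1) * n := by positivity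
      omega

/-- The two corners cannot coincide, by coprimality and V ≤ nm; the remaining two cases are
exchanged by swapping n and m. -/
theorem Notch.step {n m : ℕ} (hnm : n.Coprime m) {G G' : Set ℕ} {l U V : ℕ}
    (h : Notch n m G l U V) (hG' : ∀ q, q ∈ G' ↔ q ∈ G ∨ q ∈ translate n m l)
    (hcl : ∀ q ∈ G', ∀ r ∈ translate n m q, r ∈ G') {l' : ℕ} (hl' : l' ∉ G') (hU : U < l') :
    ∃ U' V', Notch n m G' l' U' V' ∧ U' + V' = V + l' := by
  have hl2 := hl'
  rw [hG', not_or] at hl2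
  obtain ⟨c, d, hV⟩ := h.gap l' hl2.1 hl2.2 hU
  have hn : 0 < n := by
    rcases Nat.eq_zero_or_pos n with rfl | h0
    · have := h.le; have := h.lt; omega
    · exact h0
  have hm : 0 < m := by
    rcases Nat.eq_zero_or_pos m with rfl | h0
    · have := h.le; have := h.lt; omega
    · exact h0
  have p1 : 0 < (c + 1) * n := by positivity
  have p2 : 0 < (d + 1) * m := by positivity
  rcases lt_trichotomy ((c + 1) * n) ((d + 1) * m) with hlt | heq | hgt
  · exact ⟨_, _, notch_step_aux hnm h hG' hcl hU hV hlt, by omega⟩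
  · exfalso
    have : (d + 1) * m < n * m := by have := h.le; omega
    have := eq_zero_of_mul_eq_mul hnm (Nat.lt_of_mul_lt_mul_right this) heq
    omega
  · refine ⟨_, _, (notch_step_aux hnm.symm h.swap (fun q => ?_) (fun q hq r hr => ?_) hU
      (c := d) (d := c) (by omega) hgt).swap, by omega⟩
    · rw [translate_swap m n]; exact hG' q
    · rw [translate_swap m n] at hr; exact hcl q hq r hr

/-- This is Sylvester's description of the gaps of Γ: nm is not a positive combination of n and m,
and each p is congruent to some bm modulo n with b < n. -/
theorem notch_base {n m : ℕ} (hnm : n.Coprime m) (hn : 2 ≤ n) (hlt : n < m) :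
    Notch n m (translate n m n) m (n + m) (n * m) := by
  have hm : 0 < m := by omega
  have main : ∀ a b b', (a + 1) * n + b' * m = (b + 1) * m → n * m ≤ (b + 1) * m := by
    intro a b b' e
    have hb : b' ≤ b + 1 := by
      by_contra hb
      have : (b + 1) * m ≤ b' * m := by gcongr; omega
      have : 0 < (a + 1) * n := by positivity
      omega
    obtain ⟨t, ht⟩ := Nat.exists_eq_add_of_le hb
    have e2 : (a + 1) * n = t * m := by rw [ht] at e; nlinarith
    have hnt : n ≤ t := by
      by_contra hc
      have := eq_zero_of_mul_eq_mul hnm (by omega) e2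
      subst this
      have : 0 < (a + 1) * n := by positivity
      omega
    gcongr
    omega
  refine ⟨⟨0, 1, by ring⟩, ⟨1, 0, by ring⟩, by nlinarith, le_rfl, ?_, ?_, ?_⟩
  · rintro q ⟨a, b, e⟩ ⟨a', b', rfl⟩
    rcases Nat.eq_zero_or_pos a' with rfl | ha'
    · right
      have := main a b' b (by nlinarith)
      nlinarith
    · obtain ⟨t, rfl⟩ := Nat.exists_eq_add_of_le ha'
      exact Or.inl ⟨t, b', by ring⟩
  · intro p h1 h2 h3
    obtain ⟨b, hb, hbp⟩ : ∃ b < n, b * m ≡ p [MOD n] := by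
      obtain ⟨g, hg⟩ := Nat.exists_mul_mod_eq_one_of_coprime hnm.symm hn
      refine ⟨(g * p) % n, Nat.mod_lt _ (by omega), ?_⟩
      have h4 : m * g ≡ 1 [MOD n] := by
        rw [Nat.ModEq, hg.2, Nat.mod_eq_of_lt (by omega)]
      calc (g * p) % n * m ≡ (g * p) * m [MOD n] := (Nat.mod_modEq _ _).mul_right _
        _ = (m * g) * p := by ring
        _ ≡ 1 * p [MOD n] := h4.mul_right _
        _ = p := one_mul p
    rcases le_or_gt (b * m) p with hle | hgt
    · exfalso
      obtain ⟨t, ht⟩ := (Nat.modEq_iff_dvd' hle).1 hbp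
      have e : p = b * m + n * t := by omega
      rcases Nat.eq_zero_or_pos t with rfl | h0
      · rcases Nat.eq_zero_or_pos b with rfl | h0
        · omega
        · obtain ⟨r, rfl⟩ := Nat.exists_eq_add_of_le h0
          exact h2 ⟨0, r, by rw [e]; ring⟩
      · obtain ⟨r, rfl⟩ := Nat.exists_eq_add_of_le h0
        exact h1 ⟨r, b, by rw [e]; ring⟩
    · obtain ⟨t, ht⟩ := (Nat.modEq_iff_dvd' hgt.le).1 hbp.symm
      have e : b * m = p + n * t := by omega
      rcases Nat.eq_zero_or_pos t with rfl | h0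
      · omega
      · obtain ⟨r, rfl⟩ := Nat.exists_eq_add_of_le h0
        obtain ⟨u, rfl⟩ := Nat.exists_eq_add_of_lt hb
        exact ⟨r, u, by nlinarith⟩
  · rintro q hq e
    have : ∃ a b, (a + 1) * n + (b + 1) * m = n * m := by
      rcases hq with ⟨a, b, rfl⟩ | ⟨a, b, rfl⟩
      · exact ⟨a + 1, b, by rw [← e]; ring⟩
      · exact ⟨a, b + 1, by rw [← e]; ring⟩
    obtain ⟨a, b, e⟩ := this
    exact Nat.Coprime.mul_add_mul_ne_mul hnm (Nat.succ_ne_zero a) (Nat.succ_ne_zero b) e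

/-- The weight of the inner corner opposite to `axis n m lam k` in the staircase of the semimodule
generated by the first `k + 1` elements of `lam`. -/
def coaxis (n m : ℕ) (lam : ℕ → ℕ) : ℕ → ℕ
  | 0 => 0
  | 1 => n * m
  | k + 2 => coaxis n m lam (k + 1) + lam (k + 2) - axis n m lam (k + 2)

theorem notch_coaxis {n m : ℕ} (hnm : n.Coprime m) (hn : 2 ≤ n) (hlt : n < m) {lam : ℕ → ℕ}
    (h0 : lam 0 = n) (h1 : lam 1 = m) (k : ℕ) (hind : ∀ l, l ≤ k + 1 → lam l ∉ generated n m lam l)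
    (hinc : ∀ l, 1 ≤ l → l ≤ k → axis n m lam l < lam (l + 1)) :
    Notch n m (generated n m lam (k + 1)) (lam (k + 1)) (axis n m lam (k + 1))
      (coaxis n m lam (k + 1)) := by
  induction k with
  | zero =>
    have hb := notch_base hnm hn hlt
    have hg : generated n m lam 1 = translate n m n := by
      ext q
      rw [mem_generated_succ, h0]
      constructor
      · rintro (⟨l, hl, _⟩ | h)
        · omega
        · exact h
      · exact Or.inr
    rw [axis, hg, h1, hb.sInf_eq]
    exact hb
  | succ k ih =>
    have hV := ih (fun l hl => hind l (by omega)) fun l hl hl' => hinc l hl (by omega)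
    obtain ⟨U', V', h, e⟩ := hV.step hnm (G' := generated n m lam (k + 1 + 1))
      (fun q => mem_generated_succ) (fun q hq r hr => mem_generated_of_translate hq hr)
      (hind _ (by omega)) (hinc (k + 1) (by omega) le_rfl)
    have hU : axis n m lam (k + 1 + 1) = U' := by rw [axis, h.sInf_eq]
    have hV' : coaxis n m lam (k + 1 + 1) = V' := by
      rw [coaxis, hU]; change U' + V' = _ + lam (k + 2) at e; omega
    rw [hU, hV']
    exact h

/-- Each step changes the second corner by λ - u ≤ 0. Later axes therefore stay below all earlier
second corners. -/
theorem coaxis_le {n m : ℕ} {lam : ℕ → ℕ} {k : ℕ}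
    (h : ∀ l, l ≤ k → lam l ≤ axis n m lam l) {j : ℕ} (hj : 1 ≤ j) (hjk : j ≤ k) :
    coaxis n m lam k ≤ coaxis n m lam j := by
  induction k, hjk using Nat.le_induction with
  | base => exact le_rfl
  | succ k hk ih =>
    refine le_trans ?_ (ih fun l hl => h l (by omega))
    obtain ⟨r, rfl⟩ := Nat.exists_eq_add_of_le' (hj.trans hk)
    rw [coaxis]
    have := h (r + 2) le_rfl
    omega

section PowerSeries

open MvPowerSeries

/-! ### The monomial form of the charts -/

/-- Every blowing-up is monomial, so the chart is x = u^n w^a, y = u^m w^b with w = v + c and an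
exponent matrix of determinant ±1. The determinant yields coprimality of n, m and the comparison of
logarithmic forms in `le_nuE_iff`. -/
theorem CuspidalSeq.chart_eq (S : CuspidalSeq) :
    0 < S.n ∧ 0 < S.m ∧ ∃ a b : ℕ, (S.n * b = S.m * a + 1 ∨ S.m * a = S.n * b + 1) ∧
      ∀ c : ℂ, S.chart c 0 = X 0 ^ S.n * (X 1 + C c) ^ a ∧
        S.chart c 1 = X 0 ^ S.m * (X 1 + C c) ^ b := by
  induction S with
  | single =>
    refine ⟨one_pos, one_pos, 0, 1, Or.inl rfl, fun c => ⟨?_, ?_⟩⟩ <;>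
      simp [chart, n, m, puiseux]
  | free S ih =>
    obtain ⟨hn, hm, a, b, hdet, h⟩ := ih
    have hn' : (free S).n = S.n := rfl
    have hm' : (free S).m = S.m + S.n := rfl
    rw [hn', hm']
    refine ⟨hn, by omega, a, a + b, by rcases hdet with h | h <;> [left; right] <;> nlinarith,
      fun c => ?_⟩
    have hs : HasSubst (S.chart c) := hasSubst_of_constantCoeff_zero fun i => by
      fin_cases i
      · simp [(h c).1, hn.ne']
      · simp [(h c).2, hm.ne']
    constructor
    · simp [chart, PlaneMap.comp, subst_X hs, (h c).1]
    · simp only [chart, PlaneMap.comp, Matrix.cons_val_one, Matrix.cons_val_fin_one,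
        subst_mul hs, subst_X hs, (h c).1, (h c).2]
      ring
  | corner S ih =>
    obtain ⟨hn, hm, a, b, hdet, h⟩ := ih
    have hn' : (corner S).n = S.m := rfl
    have hm' : (corner S).m = S.n + S.m := rfl
    rw [hn', hm']
    refine ⟨hm, by omega, b, a + b, by rcases hdet with h | h <;> [right; left] <;> nlinarith,
      fun c => ?_⟩
    have hs : HasSubst (S.chart c) := hasSubst_of_constantCoeff_zero fun i => by
      fin_cases i
      · simp [(h c).1, hn.ne']
      · simp [(h c).2, hm.ne']
    constructor
    · simp [chart, PlaneMap.comp, subst_X hs, (h c).2]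
    · simp only [chart, PlaneMap.comp, Matrix.cons_val_one, Matrix.cons_val_fin_one,
        subst_mul hs, subst_X hs, (h c).1, (h c).2]
      ring

theorem CuspidalSeq.n_pos (S : CuspidalSeq) : 0 < S.n := S.chart_eq.1

theorem CuspidalSeq.m_pos (S : CuspidalSeq) : 0 < S.m := S.chart_eq.2.1

theorem CuspidalSeq.coprime (S : CuspidalSeq) : S.n.Coprime S.m := by
  obtain ⟨-, -, a, b, h, -⟩ := S.chart_eq
  rw [← Nat.isCoprime_iff_coprime]
  rcases h with h | h
  · exact ⟨b, -a, by zify at h; linarith⟩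
  · exact ⟨-b, a, by zify at h; linarith⟩

theorem CuspidalSeq.n_lt_m (S : CuspidalSeq) (h : 2 ≤ S.n) : S.n < S.m := by
  cases S with
  | single => simp [n, puiseux] at h
  | free S => exact Nat.lt_add_of_pos_left S.m_pos
  | corner S => exact Nat.lt_add_of_pos_left S.n_pos

/-! ### Weighted orders -/

/-- The weights `n` and `m` of the coordinates `x` and `y`. -/
abbrev wt (n m : ℕ) : Fin 2 → ℕ := ![n, m]

theorem weight_wt (n m : ℕ) (e : Fin 2 →₀ ℕ) :
    Finsupp.weight (wt n m) e = e 0 * n + e 1 * m := by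
  simp [Finsupp.weight_apply, Finsupp.sum_fintype]

theorem weightedOrder_monomial_mul (w : Fin 2 → ℕ) (e : Fin 2 →₀ ℕ) (f : MvPowerSeries (Fin 2) ℂ) :
    weightedOrder w (monomial e 1 * f) = Finsupp.weight w e + weightedOrder w f := by
  refine le_antisymm ?_ ?_
  · rcases eq_or_ne f 0 with rfl | hf
    · simp
    obtain ⟨d, hd, hw⟩ := exists_coeff_ne_zero_and_weightedOrder w
      ((ne_zero_iff_weightedOrder_finite w).1 hf)
    rw [← hw, ← Nat.cast_add, ← map_add]
    refine weightedOrder_le w ?_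
    rwa [coeff_add_monomial_mul, one_mul]
  · refine le_trans ?_ (le_weightedOrder_mul w)
    rw [weightedOrder_monomial_of_ne_zero w one_ne_zero]

/-- The order of the 1-form `ω` for the weights `n` and `m` of `x` and `y`, the forms `dx` and `dy`
having the weights of `x` and `y`. -/
def wOrder (n m : ℕ) (ω : OneForm) : ℕ∞ :=
  min (weightedOrder (wt n m) (ω.1 : MvPowerSeries (Fin 2) ℂ) + n)
    (weightedOrder (wt n m) (ω.2 : MvPowerSeries (Fin 2) ℂ) + m)

theorem isConvergent_monomial (e : Fin 2 →₀ ℕ) : IsConvergent (monomial e (1 : ℂ)) := by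
  classical
  refine ⟨1, one_pos, summable_of_ne_finset_zero (s := {e}) fun d hd => ?_⟩
  rw [coeff_monomial, if_neg (by simpa using hd)]
  simp

/-- The exponent `(a, b)`. -/
def expo (a b : ℕ) : Fin 2 →₀ ℕ := Finsupp.single 0 a + Finsupp.single 1 b

@[simp] theorem expo_zero (a b : ℕ) : expo a b 0 = a := by simp [expo]

@[simp] theorem expo_one (a b : ℕ) : expo a b 1 = b := by simp [expo]

theorem eq_expo (e : Fin 2 →₀ ℕ) : e = expo (e 0) (e 1) := by
  ext i; fin_cases i <;> simp

/-- The germ `x ^ a * y ^ b`. -/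
def xy (a b : ℕ) : Germ := ⟨monomial (expo a b) 1, isConvergent_monomial _⟩

theorem coe_xy (a b : ℕ) : (xy a b : MvPowerSeries (Fin 2) ℂ) = monomial (expo a b) 1 := rfl

theorem wOrder_xy_smul (n m a b : ℕ) (ω : OneForm) :
    wOrder n m (xy a b • ω) = (a * n + b * m : ℕ) + wOrder n m ω := by
  have h : ∀ g : Germ, weightedOrder (wt n m) ((xy a b * g : Germ) : MvPowerSeries (Fin 2) ℂ) =
      (a * n + b * m : ℕ) + weightedOrder (wt n m) (g : MvPowerSeries (Fin 2) ℂ) := by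
    intro g
    have := weightedOrder_monomial_mul (wt n m) (expo a b) g
    rw [weight_wt, expo_zero, expo_one] at this
    exact this
  rw [wOrder, wOrder, Prod.smul_fst, Prod.smul_snd, smul_eq_mul, smul_eq_mul, h, h,
      ← min_add_add_left,
    add_assoc, add_assoc]

theorem min_wOrder_le_add (n m : ℕ) (ω η : OneForm) :
    min (wOrder n m ω) (wOrder n m η) ≤ wOrder n m (ω + η) := by
  have h1 := min_weightedOrder_le_add (wt n m) (f := (ω.1 : MvPowerSeries (Fin 2) ℂ)) (g := η.1)
  have h2 := min_weightedOrder_le_add (wt n m) (f := (ω.2 : MvPowerSeries (Fin 2) ℂ)) (g := η.2)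
  refine le_min ?_ ?_
  · refine le_trans ?_ (add_le_add_left h1 _)
    rw [← min_add_add_right]
    exact min_le_min (min_le_left _ _) (min_le_left _ _)
  · refine le_trans ?_ (add_le_add_left h2 _)
    rw [← min_add_add_right]
    exact min_le_min (min_le_right _ _) (min_le_right _ _)

theorem le_wOrder_smul (n m : ℕ) (c : ℂ) (ω : OneForm) :
    wOrder n m ω ≤ wOrder n m (c • ω) := by
  have h : ∀ g : Germ, weightedOrder (wt n m) (g : MvPowerSeries (Fin 2) ℂ) ≤
      weightedOrder (wt n m) ((c • g : Germ) : MvPowerSeries (Fin 2) ℂ) := fun g =>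
    le_weightedOrder_smul (wt n m)
  exact min_le_min (add_le_add_left (h _) _) (add_le_add_left (h _) _)

theorem wOrder_smul (n m : ℕ) {c : ℂ} (hc : c ≠ 0) (ω : OneForm) :
    wOrder n m (c • ω) = wOrder n m ω := by
  refine le_antisymm ?_ (le_wOrder_smul n m c ω)
  have := le_wOrder_smul n m c⁻¹ (c • ω)
  rwa [smul_smul, inv_mul_cancel₀ hc, one_smul] at this

theorem le_wOrder_iff {n m p : ℕ} {ω : OneForm} : (p : ℕ∞) ≤ wOrder n m ω ↔
    (∀ a b, a * n + b * m + n < p → coeff (expo a b) (ω.1 : MvPowerSeries (Fin 2) ℂ) = 0) ∧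
    (∀ a b, a * n + b * m + m < p → coeff (expo a b) (ω.2 : MvPowerSeries (Fin 2) ℂ) = 0) := by
  have h : ∀ (r : ℕ) (g : MvPowerSeries (Fin 2) ℂ),
      (p : ℕ∞) ≤ weightedOrder (wt n m) g + r ↔
        ∀ a b, a * n + b * m + r < p → coeff (expo a b) g = 0 := by
    intro r g
    constructor
    · intro h a b hab
      refine coeff_eq_zero_of_lt_weightedOrder (wt n m) ?_
      rw [weight_wt, expo_zero, expo_one]
      have h' : ((a * n + b * m + r : ℕ) : ℕ∞) < weightedOrder (wt n m) g + r :=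
        lt_of_lt_of_le (by exact_mod_cast hab) h
      push_cast at h' ⊢
      exact lt_of_add_lt_add_right h'
    · intro h
      have : ((p - r : ℕ) : ℕ∞) ≤ weightedOrder (wt n m) g := by
        refine nat_le_weightedOrder (wt n m) fun d hd => ?_
        rw [weight_wt] at hd
        rw [eq_expo d]
        exact h _ _ (by omega)
      refine le_trans ?_ (add_le_add_left this (r : ℕ∞))
      exact_mod_cast (by omega : p ≤ p - r + r)
  rw [wOrder, le_min_iff, h, h]

theorem X_pow_dvd_subst {τ : Type} (s : τ) {F : Fin 2 → MvPowerSeries τ ℂ} (hF : HasSubst F)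
    {n m : ℕ} (h0 : X s ^ n ∣ F 0) (h1 : X s ^ m ∣ F 1) {f : MvPowerSeries (Fin 2) ℂ} {p : ℕ}
    (hp : (p : ℕ∞) ≤ weightedOrder (wt n m) f) : X s ^ p ∣ subst F f := by
  rw [X_pow_dvd_iff]
  intro e he
  rw [coeff_subst hF]
  refine finsum_eq_zero_of_forall_eq_zero fun d => ?_
  by_cases hd : coeff d f = 0
  · rw [hd, zero_smul]
  have hw : p ≤ d 0 * n + d 1 * m := by
    have := hp.trans (weightedOrder_le (wt n m) hd)
    rw [weight_wt] at this
    exact_mod_cast this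
  have hdvd : X s ^ p ∣ d.prod fun i k => F i ^ k := by
    refine (pow_dvd_pow _ hw).trans ?_
    rw [Finsupp.prod_fintype _ _ (by simp), Fin.prod_univ_two, pow_add, mul_comm (d 0),
      mul_comm (d 1), pow_mul, pow_mul]
    exact mul_dvd_mul (pow_dvd_pow_of_dvd h0 _) (pow_dvd_pow_of_dvd h1 _)
  rw [X_pow_dvd_iff.1 hdvd e he, smul_zero]

theorem X_pow_dvd_subst_mul {τ : Type} (s : τ) {F : Fin 2 → MvPowerSeries τ ℂ} (hF : HasSubst F)
    {n m : ℕ} (h0 : X s ^ n ∣ F 0) (h1 : X s ^ m ∣ F 1) {f : MvPowerSeries (Fin 2) ℂ} {p r : ℕ}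
    (hp : (p : ℕ∞) ≤ weightedOrder (wt n m) f + r) {g : MvPowerSeries τ ℂ} (hg : X s ^ r ∣ g) :
    X s ^ p ∣ subst F f * g := by
  have h : ((p - r : ℕ) : ℕ∞) ≤ weightedOrder (wt n m) f := by
    rw [ENat.natCast_sub]
    exact tsub_le_iff_right.2 hp
  refine (pow_dvd_pow _ (by omega : p ≤ p - r + r)).trans ?_
  rw [pow_add]
  exact mul_dvd_mul (X_pow_dvd_subst s hF h0 h1 h) hg

theorem subst_xy {τ : Type} {F : Fin 2 → MvPowerSeries τ ℂ} (hF : HasSubst F) (a b : ℕ) :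
    subst F (xy a b : MvPowerSeries (Fin 2) ℂ) = F 0 ^ a * F 1 ^ b := by
  rw [coe_xy, subst_monomial hF, Finsupp.prod_fintype _ _ (by simp), Fin.prod_univ_two]
  simp

/-! ### The leading part of a form -/

/-- The form `x ^ a y ^ b (α dx / x + β dy / y)`. -/
def leading (a b : ℕ) (α β : ℂ) : OneForm := (α • xy (a - 1) b, β • xy a (b - 1))

theorem rep_unique {n m a b a' b' : ℕ} (hnm : n.Coprime m) (h : a * n + b * m = a' * n + b' * m)
    (hlt : a * n + b * m < n * m) : a = a' ∧ b = b' := by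
  wlog hab : b ≤ b' generalizing a b a' b'
  · have := this h.symm (h ▸ hlt) (le_of_not_ge hab)
    exact ⟨this.1.symm, this.2.symm⟩
  obtain ⟨t, rfl⟩ := Nat.exists_eq_add_of_le hab
  have hm : 0 < m := Nat.pos_of_ne_zero (by rintro rfl; omega)
  have hn : 0 < n := Nat.pos_of_ne_zero (by rintro rfl; omega)
  have ht : t < n := by
    have : t * m < n * m := by nlinarith [Nat.zero_le (a' * n), Nat.zero_le (b * m)]
    exact Nat.lt_of_mul_lt_mul_right this
  have ha : a' ≤ a := by
    by_contra hc
    have : a * n < a' * n := Nat.mul_lt_mul_of_pos_right (not_le.1 hc) hn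
    have : (b + t) * m = b * m + t * m := by ring
    omega
  obtain ⟨r, rfl⟩ := Nat.exists_eq_add_of_le ha
  have e : r * n = t * m := by nlinarith
  have := eq_zero_of_mul_eq_mul hnm ht e
  subst this
  have : r = 0 := by
    rcases Nat.eq_zero_or_pos r with h | h
    · exact h
    · have : 0 < r * n := by positivity
      omega
  subst this
  simp

theorem coeff_smul_xy (a b a' b' : ℕ) (c : ℂ) :
    coeff (expo a' b') ((c • xy a b : Germ) : MvPowerSeries (Fin 2) ℂ) =
      if a' = a ∧ b' = b then c else 0 := by
  classical
  have h : expo a' b' = expo a b ↔ a' = a ∧ b' = b := by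
    constructor
    · intro h
      have h0 := DFunLike.congr_fun h 0
      have h1 := DFunLike.congr_fun h 1
      simp only [expo_zero, expo_one] at h0 h1
      exact ⟨h0, h1⟩
    · rintro ⟨rfl, rfl⟩; rfl
  change coeff (expo a' b') (c • (monomial (expo a b) (1 : ℂ))) = _
  rw [coeff_smul, coeff_monomial]
  simp [h]

/-- By `rep_unique` at most one monomial has weight p < nm, so the part of weight p is x^a y^b (α
dx/x + β dy/y). -/
theorem exists_leading {n m p : ℕ} (hnm : n.Coprime m) (hp : p < n * m) {ω : OneForm}
    (h : (p : ℕ∞) ≤ wOrder n m ω) : ((p + 1 : ℕ) : ℕ∞) ≤ wOrder n m ω ∨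
    ∃ (a b : ℕ) (α β : ℂ), p = a * n + b * m ∧ (a = 0 → α = 0) ∧ (b = 0 → β = 0) ∧
      ((p + 1 : ℕ) : ℕ∞) ≤ wOrder n m (ω - leading a b α β) := by
  rw [le_wOrder_iff] at h
  by_cases hrep : ∃ a b, p = a * n + b * m
  · right
    obtain ⟨a, b, hab⟩ := hrep
    -- For a = 0 the truncated exponent `a - 1` would point to a monomial of the wrong weight, so α
    -- must be set to 0; likewise β for b = 0.
    refine ⟨a, b, if a = 0 then 0 else coeff (expo (a - 1) b) (ω.1 : MvPowerSeries (Fin 2) ℂ),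
      if b = 0 then 0 else coeff (expo a (b - 1)) (ω.2 : MvPowerSeries (Fin 2) ℂ), hab,
      fun h => if_pos h, fun h => if_pos h, ?_⟩
    rw [le_wOrder_iff]
    constructor <;> intro a' b' hlt
    · change coeff _ ((ω.1 : MvPowerSeries (Fin 2) ℂ) - _) = 0
      rw [map_sub, leading, coeff_smul_xy]
      rcases Nat.lt_succ_iff_lt_or_eq.1 hlt with h' | h'
      · rw [h.1 _ _ h']
        split_ifs with h1 h2 <;> try simp
        obtain ⟨rfl, rfl⟩ := h1
        exact h.1 _ _ h'
      · have e : (a' + 1) * n + b' * m = a * n + b * m := by rw [← hab, ← h']; ring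
        obtain ⟨rfl, rfl⟩ := rep_unique hnm e (by rw [e, ← hab]; exact hp)
        simp
    · change coeff _ ((ω.2 : MvPowerSeries (Fin 2) ℂ) - _) = 0
      rw [map_sub, leading, coeff_smul_xy]
      rcases Nat.lt_succ_iff_lt_or_eq.1 hlt with h' | h'
      · rw [h.2 _ _ h']
        split_ifs with h1 h2 <;> try simp
        obtain ⟨rfl, rfl⟩ := h1
        exact h.2 _ _ h'
      · have e : a' * n + (b' + 1) * m = a * n + b * m := by rw [← hab, ← h']; ring
        obtain ⟨rfl, rfl⟩ := rep_unique hnm e (by rw [e, ← hab]; exact hp)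
        simp
  · left
    rw [le_wOrder_iff]
    constructor <;> intro a b hab
    · rcases Nat.lt_succ_iff_lt_or_eq.1 hab with h' | h'
      · exact h.1 a b h'
      · exact absurd ⟨a + 1, b, by rw [← h']; ring⟩ hrep
    · rcases Nat.lt_succ_iff_lt_or_eq.1 hab with h' | h'
      · exact h.2 a b h'
      · exact absurd ⟨a, b + 1, by rw [← h']; ring⟩ hrep

/-! ### The parametrization and differential values -/

namespace ECusp

variable (K : ECusp)

/-- Along the strict transform u has order 1 by transversality, and w = v + c is a unit because c ≠
0. -/
theorem exists_param : ∃ e₀ e₁ : PowerSeries ℂ, PowerSeries.constantCoeff e₀ ≠ 0 ∧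
    PowerSeries.constantCoeff e₁ ≠ 0 ∧ K.param 0 = PowerSeries.X ^ K.S.n * e₀ ∧
    K.param 1 = PowerSeries.X ^ K.S.m * e₁ := by
  have hs : HasSubst K.strict := hasSubst_of_constantCoeff_zero K.centered
  obtain ⟨hn, hm, a, b, -, h⟩ := K.S.chart_eq
  obtain ⟨g, hg⟩ := PowerSeries.X_dvd_iff.2 (K.centered 0)
  have hg0 : PowerSeries.constantCoeff g ≠ 0 := by
    have := K.transverse
    rw [hg, ← zero_add 1, PowerSeries.coeff_succ_X_mul] at this
    simpa using this
  have hw : PowerSeries.constantCoeff (K.strict 1 + PowerSeries.C K.point) ≠ 0 := by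
    rw [map_add, K.centered, zero_add, PowerSeries.constantCoeff_C]
    exact K.point_ne_zero
  have key : ∀ k l : ℕ, (subst K.strict (X 0 ^ k * (X 1 + C K.point) ^ l) : PowerSeries ℂ) =
      PowerSeries.X ^ k * (g ^ k * (K.strict 1 + PowerSeries.C K.point) ^ l) := by
    intro k l
    rw [subst_mul hs, subst_pow hs, subst_pow hs, subst_add hs, subst_X hs, subst_X hs, subst_C, hg,
      mul_pow, mul_assoc]
    rfl
  refine ⟨_, _, ?_, ?_, (congrArg _ (h K.point).1).trans (key _ _),
    (congrArg _ (h K.point).2).trans (key _ _)⟩ <;>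
  · rw [map_mul, map_pow, map_pow]
    exact mul_ne_zero (pow_ne_zero _ hg0) (pow_ne_zero _ hw)

theorem hasSubst_param : HasSubst K.param := by
  obtain ⟨e₀, e₁, -, -, h0, h1⟩ := K.exists_param
  refine hasSubst_of_constantCoeff_zero fun i => ?_
  change PowerSeries.constantCoeff (K.param i) = 0
  fin_cases i
  · simp [h0, K.S.n_pos.ne']
  · simp [h1, K.S.m_pos.ne']

/-- The restriction of a germ of function to the cusp. -/
def eval (f : Germ) : PowerSeries ℂ := subst K.param (f : MvPowerSeries (Fin 2) ℂ)

/-- The series `a(t)` such that `φ^* ω = a(t) dt / t`. -/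
def pull (ω : OneForm) : PowerSeries ℂ :=
  PowerSeries.X * (K.eval ω.1 * PowerSeries.derivative ℂ (K.param 0) +
    K.eval ω.2 * PowerSeries.derivative ℂ (K.param 1))

theorem nu_eq (ω : OneForm) : K.nu ω = (K.pull ω).order := rfl

theorem eval_add (f g : Germ) : K.eval (f + g) = K.eval f + K.eval g :=
  subst_add K.hasSubst_param _ _

theorem eval_mul (f g : Germ) : K.eval (f * g) = K.eval f * K.eval g :=
  subst_mul K.hasSubst_param _ _

theorem eval_smul (c : ℂ) (f : Germ) : K.eval (c • f) = c • K.eval f :=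
  subst_smul K.hasSubst_param _ _

theorem eval_xy (a b : ℕ) : K.eval (xy a b) = K.param 0 ^ a * K.param 1 ^ b :=
  subst_xy K.hasSubst_param a b

theorem pull_add (ω η : OneForm) : K.pull (ω + η) = K.pull ω + K.pull η := by
  simp only [pull, Prod.fst_add, Prod.snd_add, eval_add]
  ring

theorem pull_mul (f : Germ) (ω : OneForm) : K.pull (f • ω) = K.eval f * K.pull ω := by
  simp only [pull, Prod.smul_fst, Prod.smul_snd, smul_eq_mul, eval_mul]
  ring

theorem pull_smul (c : ℂ) (ω : OneForm) : K.pull (c • ω) = c • K.pull ω := by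
  simp only [pull, Prod.smul_fst, Prod.smul_snd, eval_smul, smul_mul_assoc, mul_smul_comm, smul_add,
    mul_add]

theorem pull_sub (ω η : OneForm) : K.pull (ω - η) = K.pull ω - K.pull η := by
  rw [sub_eq_add_neg, ← neg_one_smul ℂ η, pull_add, pull_smul, neg_one_smul, sub_eq_add_neg]

theorem nu_mul (f : Germ) (ω : OneForm) : K.nu (f • ω) = (K.eval f).order + K.nu ω := by
  rw [nu_eq, nu_eq, pull_mul, PowerSeries.order_mul]

theorem order_param_zero : (K.param 0).order = K.S.n := by
  obtain ⟨e₀, e₁, he, -, h0, -⟩ := K.exists_param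
  have : e₀.order = 0 := by
    by_contra h
    exact he (PowerSeries.order_ne_zero_iff_constCoeff_eq_zero.1 h)
  rw [h0, PowerSeries.order_mul, PowerSeries.order_X_pow, this, add_zero]

theorem order_param_one : (K.param 1).order = K.S.m := by
  obtain ⟨e₀, e₁, -, he, -, h0⟩ := K.exists_param
  have : e₁.order = 0 := by
    by_contra h
    exact he (PowerSeries.order_ne_zero_iff_constCoeff_eq_zero.1 h)
  rw [h0, PowerSeries.order_mul, PowerSeries.order_X_pow, this, add_zero]

theorem nu_xy_smul (a b : ℕ) (ω : OneForm) :
    K.nu (xy a b • ω) = (a * K.S.n + b * K.S.m : ℕ) + K.nu ω := by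
  rw [nu_mul, eval_xy, PowerSeries.order_mul, PowerSeries.order_pow, PowerSeries.order_pow,
    order_param_zero, order_param_one]
  simp

theorem min_nu_le_add (ω η : OneForm) : min (K.nu ω) (K.nu η) ≤ K.nu (ω + η) := by
  rw [nu_eq, nu_eq, nu_eq, pull_add]
  exact PowerSeries.min_order_le_order_add _ _

theorem nu_smul {c : ℂ} (hc : c ≠ 0) (ω : OneForm) : K.nu (c • ω) = K.nu ω := by
  have h : ∀ (c : ℂ) (η : OneForm), K.nu η ≤ K.nu (c • η) := fun c η => by
    rw [nu_eq, nu_eq, pull_smul]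
    exact PowerSeries.le_order_smul
  refine le_antisymm ?_ (h c ω)
  have := h c⁻¹ (c • ω)
  rwa [smul_smul, inv_mul_cancel₀ hc, one_smul] at this

theorem exists_nu_sub_lt {ω η : OneForm} {p : ℕ} (h : K.nu ω = p) (h' : K.nu η = p) :
    ∃ c : ℂ, c ≠ 0 ∧ (p : ℕ∞) < K.nu (ω - c • η) := by
  rw [nu_eq, PowerSeries.order_eq_nat] at h h'
  refine ⟨PowerSeries.coeff p (K.pull ω) / PowerSeries.coeff p (K.pull η), div_ne_zero h.1 h'.1, ?_⟩
  have : ((p + 1 : ℕ) : ℕ∞) ≤ K.nu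
      (ω - (PowerSeries.coeff p (K.pull ω) / PowerSeries.coeff p (K.pull η)) • η) := by
    rw [nu_eq]
    refine PowerSeries.nat_le_order _ _ fun i hi => ?_
    rw [pull_sub, pull_smul, map_sub, PowerSeries.coeff_smul, smul_eq_mul]
    rcases Nat.lt_succ_iff_lt_or_eq.1 hi with hi | rfl
    · rw [h.2 i hi, h'.2 i hi]; simp
    · rw [div_mul_cancel₀ _ h'.1, sub_self]
  exact lt_of_lt_of_le (by exact_mod_cast Nat.lt_succ_self p) this

theorem X_mul_derivative (k : ℕ) (e : PowerSeries ℂ) :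
    PowerSeries.X * PowerSeries.derivative ℂ (PowerSeries.X ^ k * e) =
      PowerSeries.X ^ k * ((k : PowerSeries ℂ) * e + PowerSeries.X * PowerSeries.derivative ℂ e) := by
  rw [Derivation.leibniz, PowerSeries.derivative_pow, PowerSeries.derivative_X]
  rcases k with _ | k
  · simp
  · simp only [smul_eq_mul, Nat.add_sub_cancel]
    ring

theorem wOrder_le_nu (ω : OneForm) : wOrder K.S.n K.S.m ω ≤ K.nu ω := by
  refine ENat.forall_natCast_le_iff_le.1 fun p hp => ?_
  obtain ⟨e₀, e₁, -, -, h0, h1⟩ := K.exists_param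
  have d0 : (PowerSeries.X : PowerSeries ℂ) ^ K.S.n ∣ K.param 0 := ⟨e₀, h0⟩
  have d1 : (PowerSeries.X : PowerSeries ℂ) ^ K.S.m ∣ K.param 1 := ⟨e₁, h1⟩
  rw [nu_eq, PowerSeries.order_eq_emultiplicity_X, ← pow_dvd_iff_le_emultiplicity, pull, mul_add,
    mul_left_comm, mul_left_comm _ (K.eval ω.2), h0, X_mul_derivative, h1, X_mul_derivative]
  rw [wOrder, le_min_iff] at hp
  exact dvd_add (X_pow_dvd_subst_mul () K.hasSubst_param d0 d1 hp.1 (dvd_mul_right _ _))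
    (X_pow_dvd_subst_mul () K.hasSubst_param d0 d1 hp.2 (dvd_mul_right _ _))

/-- On the cusp dx/x and dy/y begin with n dt/t and m dt/t. So the leading part is lost on the cusp
exactly when nα + mβ = 0. -/
theorem exists_coeff_pull_leading : ∃ x₀ y₀ : ℂ, x₀ ≠ 0 ∧ y₀ ≠ 0 ∧ ∀ (a b : ℕ) (α β : ℂ),
    (a = 0 → α = 0) → (b = 0 → β = 0) →
    PowerSeries.coeff (a * K.S.n + b * K.S.m) (K.pull (leading a b α β)) =
      (K.S.n * α + K.S.m * β) * (x₀ ^ a * y₀ ^ b) := by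
  obtain ⟨e₀, e₁, he₀, he₁, h0, h1⟩ := K.exists_param
  refine ⟨_, _, he₀, he₁, fun a b α β ha hb => ?_⟩
  have t0 : PowerSeries.X * (K.eval (α • xy (a - 1) b) * PowerSeries.derivative ℂ (K.param 0)) =
      PowerSeries.X ^ (a * K.S.n + b * K.S.m) * (α • (e₀ ^ (a - 1) * e₁ ^ b *
        ((K.S.n : PowerSeries ℂ) * e₀ + PowerSeries.X * PowerSeries.derivative ℂ e₀))) := by
    rcases a with _ | a
    · rw [ha rfl, eval_smul]; simp
    · rw [mul_left_comm, eval_smul, eval_xy, h0, X_mul_derivative, h1, smul_mul_assoc,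
        mul_smul_comm, Nat.add_sub_cancel]
      congr 1
      ring
  have t1 : PowerSeries.X * (K.eval (β • xy a (b - 1)) * PowerSeries.derivative ℂ (K.param 1)) =
      PowerSeries.X ^ (a * K.S.n + b * K.S.m) * (β • (e₀ ^ a * e₁ ^ (b - 1) *
        ((K.S.m : PowerSeries ℂ) * e₁ + PowerSeries.X * PowerSeries.derivative ℂ e₁))) := by
    rcases b with _ | b
    · rw [hb rfl, eval_smul]; simp
    · rw [mul_left_comm, eval_smul, eval_xy, h1, X_mul_derivative, h0, smul_mul_assoc,
        mul_smul_comm, Nat.add_sub_cancel]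
      congr 1
      ring
  rw [pull, leading, mul_add, t0, t1, ← mul_add, PowerSeries.coeff_X_pow_mul', if_pos le_rfl,
    Nat.sub_self, PowerSeries.coeff_zero_eq_constantCoeff_apply, map_add,
    PowerSeries.constantCoeff_smul, PowerSeries.constantCoeff_smul]
  simp only [map_mul, map_add, map_pow, map_natCast, PowerSeries.constantCoeff_X, zero_mul,
    add_zero, smul_eq_mul]
  have p0 : α * PowerSeries.constantCoeff e₀ ^ (a - 1) * PowerSeries.constantCoeff e₀ =
      α * PowerSeries.constantCoeff e₀ ^ a := by
    rcases a with _ | a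
    · simp [ha rfl]
    · rw [Nat.add_sub_cancel]; ring
  have p1 : β * PowerSeries.constantCoeff e₁ ^ (b - 1) * PowerSeries.constantCoeff e₁ =
      β * PowerSeries.constantCoeff e₁ ^ b := by
    rcases b with _ | b
    · simp [hb rfl]
    · rw [Nat.add_sub_cancel]; ring
  linear_combination (K.S.n : ℂ) * PowerSeries.constantCoeff e₁ ^ b * p0 +
    (K.S.m : ℂ) * PowerSeries.constantCoeff e₀ ^ a * p1

end ECusp

/-! ### Resonant forms: value larger than weighted order -/

namespace ECusp

variable (K : ECusp)

/-- A form of weighted order `p < nm` whose differential value is larger than `p` is, up to terms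
of higher order, a multiple of `x ^ a y ^ b (m dx / x - n dy / y)`. -/
theorem exists_resonant {ω : OneForm} {p : ℕ} (hp : p < K.S.n * K.S.m)
    (h : wOrder K.S.n K.S.m ω = p) (hlt : (p : ℕ∞) < K.nu ω) :
    ∃ (a b : ℕ) (c : ℂ), c ≠ 0 ∧ p = (a + 1) * K.S.n + (b + 1) * K.S.m ∧
      ((p + 1 : ℕ) : ℕ∞) ≤ wOrder K.S.n K.S.m
        (ω - c • leading (a + 1) (b + 1) K.S.m (-K.S.n)) := by
  have hn : (K.S.n : ℂ) ≠ 0 := Nat.cast_ne_zero.2 K.S.n_pos.ne'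
  have hm : (K.S.m : ℂ) ≠ 0 := Nat.cast_ne_zero.2 K.S.m_pos.ne'
  have hnot : ¬ ((p + 1 : ℕ) : ℕ∞) ≤ wOrder K.S.n K.S.m ω := by
    rw [h, Nat.cast_le]; omega
  obtain ⟨a, b, α, β, hab, ha, hb, hω⟩ := (exists_leading K.S.coprime hp h.ge).resolve_left hnot
  obtain ⟨x₀, y₀, hx, hy, hc⟩ := K.exists_coeff_pull_leading
  have h1 : PowerSeries.coeff p (K.pull ω) = 0 := PowerSeries.coeff_of_lt_order p hlt
  have h2 : PowerSeries.coeff p (K.pull (ω - leading a b α β)) = 0 :=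
    PowerSeries.coeff_of_lt_order p (lt_of_lt_of_le
      (lt_of_lt_of_le (by exact_mod_cast Nat.lt_succ_self p) hω) (K.wOrder_le_nu _))
  rw [pull_sub, map_sub, h1, zero_sub, neg_eq_zero, hab, hc a b α β ha hb] at h2
  have h3 : (K.S.n : ℂ) * α + K.S.m * β = 0 :=
    (mul_eq_zero.1 h2).resolve_right (mul_ne_zero (pow_ne_zero _ hx) (pow_ne_zero _ hy))
  have hα : α ≠ 0 := by
    rintro rfl
    have hβ : β = 0 := by simpa [hm] using h3
    subst hβ
    refine hnot ?_
    have h0 : leading a b 0 0 = 0 := by simp only [leading, zero_smul]; rfl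
    rwa [h0, sub_zero] at hω
  have hβ : β ≠ 0 := by
    rintro rfl
    exact hα (by simpa [hn] using h3)
  obtain ⟨a, rfl⟩ := Nat.exists_eq_succ_of_ne_zero fun h => hα (ha h)
  obtain ⟨b, rfl⟩ := Nat.exists_eq_succ_of_ne_zero fun h => hβ (hb h)
  refine ⟨a, b, α / K.S.m, div_ne_zero hα hm, hab, ?_⟩
  convert hω using 4
  have e1 : α / K.S.m * K.S.m = α := div_mul_cancel₀ _ hm
  have e2 : α / K.S.m * -K.S.n = β := by
    field_simp
    linear_combination -h3
  simp only [leading, Prod.smul_mk, smul_smul, e1, e2]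

theorem mem_translate_of_resonant {ω : OneForm} {p : ℕ} (hp : p < K.S.n * K.S.m)
    (h : wOrder K.S.n K.S.m ω = p) (hlt : (p : ℕ∞) < K.nu ω) :
    p ∈ translate K.S.n K.S.m (K.S.n + K.S.m) := by
  obtain ⟨a, b, -, -, hab, -⟩ := K.exists_resonant hp h hlt
  exact ⟨a, b, by rw [hab]; ring⟩

/-- Both parts of weight p are nonzero multiples of the same resonant form, since the exponents are
determined by p < nm. -/
theorem exists_wOrder_sub_lt {ω η : OneForm} {p : ℕ} (hp : p < K.S.n * K.S.m)
    (h : wOrder K.S.n K.S.m ω = p) (hlt : (p : ℕ∞) < K.nu ω)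
    (h' : wOrder K.S.n K.S.m η = p) (hlt' : (p : ℕ∞) < K.nu η) :
    ∃ c : ℂ, c ≠ 0 ∧ (p : ℕ∞) < wOrder K.S.n K.S.m (ω - c • η) := by
  obtain ⟨a, b, c, hc, hab, hω⟩ := K.exists_resonant hp h hlt
  obtain ⟨a', b', c', hc', hab', hη⟩ := K.exists_resonant hp h' hlt'
  obtain ⟨h1, h2⟩ := rep_unique K.S.coprime (hab.symm.trans hab') (by rw [← hab]; exact hp)
  obtain rfl : a = a' := by omega
  obtain rfl : b = b' := by omega
  refine ⟨c / c', div_ne_zero hc hc', ?_⟩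
  have h3 := hη.trans (le_wOrder_smul _ _ (-(c / c')) _)
  have h4 := (le_min hω h3).trans (min_wOrder_le_add _ _ _ _)
  refine lt_of_lt_of_le (by exact_mod_cast Nat.lt_succ_self p) (h4.trans_eq ?_)
  congr 1
  rw [smul_sub, smul_smul, neg_mul, div_mul_cancel₀ _ hc']
  module

/-! ### Comparison with the divisorial order -/

end ECusp

/-- As w is a unit, du/u and dw may be replaced by du/u and dw/w, which are related to dx/x and dy/y
by a matrix of determinant ±1. The order can thus be read on the coefficients of dx/x and dy/y. -/
theorem le_nuE_iff {S : CuspidalSeq} {ω : OneForm} {k : ℕ} : (k : ℕ∞) ≤ nuE S ω ↔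
    X 0 ^ k ∣ subst (S.chart 1) (ω.1 : MvPowerSeries (Fin 2) ℂ) * S.chart 1 0 ∧
    X 0 ^ k ∣ subst (S.chart 1) (ω.2 : MvPowerSeries (Fin 2) ℂ) * S.chart 1 1 := by
  obtain ⟨-, -, a, b, hdet, h⟩ := S.chart_eq
  obtain ⟨h0, h1⟩ := h 1
  set w : MvPowerSeries (Fin 2) ℂ := X 1 + C 1 with hw
  have hwu : IsUnit w := by
    rw [MvPowerSeries.isUnit_iff_constantCoeff]
    simp [hw]
  have dw0 : pderiv ℂ 0 w = 0 := by
    rw [hw, map_add, pderiv_C, pderiv_X_of_ne (by decide), add_zero]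
  have dw1 : pderiv ℂ 1 w = 1 := by
    rw [hw, map_add, pderiv_C, pderiv_X_self, add_zero]
  have dX1 : pderiv ℂ 1 (X 0 : MvPowerSeries (Fin 2) ℂ) = 0 := pderiv_X_of_ne (by decide)
  have du : ∀ k l : ℕ, X 0 * pderiv ℂ 0 (X 0 ^ k * w ^ l) =
      (k : MvPowerSeries (Fin 2) ℂ) * (X 0 ^ k * w ^ l) := by
    intro k l
    rw [Derivation.leibniz, pderiv_pow, pderiv_pow, dw0, pderiv_X_self]
    rcases k with _ | k
    · simp
    · simp only [smul_eq_mul, Nat.add_sub_cancel]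
      push_cast
      ring
  have dv : ∀ k l : ℕ, w * pderiv ℂ 1 (X 0 ^ k * w ^ l) =
      (l : MvPowerSeries (Fin 2) ℂ) * (X 0 ^ k * w ^ l) := by
    intro k l
    rw [Derivation.leibniz, pderiv_pow, pderiv_pow, dw1, dX1]
    rcases l with _ | l
    · simp
    · simp only [smul_eq_mul, Nat.add_sub_cancel]
      push_cast
      ring
  set A := subst (S.chart 1) (ω.1 : MvPowerSeries (Fin 2) ℂ)
  set B := subst (S.chart 1) (ω.2 : MvPowerSeries (Fin 2) ℂ)
  have e1 : X 0 * (pullback (S.chart 1) ω).1 =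
      (S.n : MvPowerSeries (Fin 2) ℂ) * (A * S.chart 1 0) +
          (S.m : MvPowerSeries (Fin 2) ℂ) * (B * S.chart 1 1) := by
    have d0 := du S.n a
    have d1 := du S.m b
    rw [← h0] at d0
    rw [← h1] at d1
    change X 0 * (A * _ + B * _) = _
    linear_combination A * d0 + B * d1
  have e2 : w * (pullback (S.chart 1) ω).2 =
      (a : MvPowerSeries (Fin 2) ℂ) * (A * S.chart 1 0) +
          (b : MvPowerSeries (Fin 2) ℂ) * (B * S.chart 1 1) := by
    have d0 := dv S.n a
    have d1 := dv S.m b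
    rw [← h0] at d0
    rw [← h1] at d1
    change w * (A * _ + B * _) = _
    linear_combination A * d0 + B * d1
  unfold nuE
  rw [le_min_iff, ← pow_dvd_iff_le_emultiplicity, ← pow_dvd_iff_le_emultiplicity,
    e1,
    ← hwu.dvd_mul_left (b := (pullback (S.chart 1) ω).2), e2]
  constructor
  · rintro ⟨d1, d2⟩
    have hdet' : (S.n * b : MvPowerSeries (Fin 2) ℂ) = S.m * a + 1 ∨
        (S.m * a : MvPowerSeries (Fin 2) ℂ) = S.n * b + 1 := by
      rcases hdet with h | h
      · left; exact_mod_cast congrArg (Nat.cast (R := MvPowerSeries (Fin 2) ℂ)) h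
      · right; exact_mod_cast congrArg (Nat.cast (R := MvPowerSeries (Fin 2) ℂ)) h
    -- Cramer's rule for the system `e1`, `e2`.
    have k1 := dvd_sub (d1.mul_left (b : MvPowerSeries (Fin 2) ℂ))
        (d2.mul_left (S.m : MvPowerSeries (Fin 2) ℂ))
    have k2 := dvd_sub (d2.mul_left (S.n : MvPowerSeries (Fin 2) ℂ))
        (d1.mul_left (a : MvPowerSeries (Fin 2) ℂ))
    rcases hdet' with h | h
    · constructor
      · convert k1 using 1
        linear_combination -(A * S.chart 1 0) * h
      · convert k2 using 1
        linear_combination -(B * S.chart 1 1) * h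
    · constructor
      · rw [← dvd_neg]
        convert k1 using 1
        linear_combination (A * S.chart 1 0) * h
      · rw [← dvd_neg]
        convert k2 using 1
        linear_combination (B * S.chart 1 1) * h
  · rintro ⟨d1, d2⟩
    exact ⟨dvd_add (d1.mul_left _) (d2.mul_left _), dvd_add (d1.mul_left _) (d2.mul_left _)⟩

theorem CuspidalSeq.hasSubst_chart (S : CuspidalSeq) (c : ℂ) : HasSubst (S.chart c) := by
  obtain ⟨hn, hm, a, b, -, h⟩ := S.chart_eq
  refine hasSubst_of_constantCoeff_zero fun i => ?_
  fin_cases i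
  · simp [(h c).1, hn.ne']
  · simp [(h c).2, hm.ne']

theorem wOrder_le_nuE (S : CuspidalSeq) (ω : OneForm) : wOrder S.n S.m ω ≤ nuE S ω := by
  refine ENat.forall_natCast_le_iff_le.1 fun p hp => ?_
  obtain ⟨-, -, a, b, -, h⟩ := S.chart_eq
  have d0 : X 0 ^ S.n ∣ S.chart 1 0 := (h 1).1 ▸ dvd_mul_right _ _
  have d1 : X 0 ^ S.m ∣ S.chart 1 1 := (h 1).2 ▸ dvd_mul_right _ _
  rw [wOrder, le_min_iff] at hp
  exact le_nuE_iff.2 ⟨X_pow_dvd_subst_mul 0 (S.hasSubst_chart 1) d0 d1 hp.1 d0,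
    X_pow_dvd_subst_mul 0 (S.hasSubst_chart 1) d0 d1 hp.2 d1⟩

/-- A leading part of weight q < p pulls back to u^q times units w^r with coefficients α, β, so ν_E
> q would force both to vanish. -/
theorem wOrder_eq_of_nuE {S : CuspidalSeq} {ω : OneForm} {p : ℕ} (hp : p < S.n * S.m)
    (h : nuE S ω = p) : wOrder S.n S.m ω = p := by
  have hle := wOrder_le_nuE S ω
  rw [h] at hle
  obtain ⟨q, hq⟩ := ENat.ne_top_iff_exists.1 (ne_top_of_le_ne_top (ENat.natCast_ne_top p) hle)
  rw [← hq, Nat.cast_le] at hle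
  rcases hle.eq_or_lt with rfl | hlt
  · exact hq.symm
  exfalso
  have hnot : ¬ ((q + 1 : ℕ) : ℕ∞) ≤ wOrder S.n S.m ω := by
    rw [← hq, Nat.cast_le]; omega
  obtain ⟨i, j, α, β, hij, hi, hj, hω⟩ :=
    (exists_leading S.coprime (hlt.trans hp) hq.le).resolve_left hnot
  have k1 : ((q + 1 : ℕ) : ℕ∞) ≤ nuE S ω := by rw [h]; exact_mod_cast hlt
  have k2 := hω.trans (wOrder_le_nuE S _)
  rw [le_nuE_iff] at k1 k2
  have hs := S.hasSubst_chart 1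
  obtain ⟨-, -, a, b, -, hch⟩ := S.chart_eq
  obtain ⟨h0, h1⟩ := hch 1
  have hX : (X 0 : MvPowerSeries (Fin 2) ℂ) ≠ 0 := fun h => by
    simpa using congrArg (coeff (Finsupp.single 0 1)) h
  have hconst : ∀ (c : ℂ) (r : ℕ), (X 0 : MvPowerSeries (Fin 2) ℂ) ^ (q + 1) ∣
      X 0 ^ q * (c • (X 1 + C 1) ^ r) → c = 0 := by
    intro c r hd
    rw [pow_succ] at hd
    have hd' := (mul_dvd_mul_iff_left (pow_ne_zero q hX)).1 hd
    obtain ⟨g, hg⟩ := hd'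
    have := congrArg constantCoeff hg
    simpa using this
  have hsub : ∀ f g : Germ, subst (S.chart 1) ((f - g : Germ) : MvPowerSeries (Fin 2) ℂ) =
      subst (S.chart 1) (f : MvPowerSeries (Fin 2) ℂ) -
          subst (S.chart 1) (g : MvPowerSeries (Fin 2) ℂ) :=
    fun f g => subst_sub hs _ _
  have hsm : ∀ (c : ℂ) (a b : ℕ),
      subst (S.chart 1) ((c • xy a b : Germ) : MvPowerSeries (Fin 2) ℂ) =
      c • (S.chart 1 0 ^ a * S.chart 1 1 ^ b) := fun c a b => by
    rw [← subst_xy hs, ← subst_smul hs]; rfl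
  have hα : α = 0 := by
    rcases i with _ | i
    · exact hi rfl
    · have := dvd_sub k1.1 k2.1
      rw [Prod.fst_sub, hsub, sub_mul, sub_sub_cancel, leading, hsm, h0, h1, smul_mul_assoc] at this
      refine hconst α (a * (i + 1) + b * j) ?_
      convert this using 1
      rw [mul_smul_comm, hij, Nat.add_sub_cancel]
      congr 1
      ring
  have hβ : β = 0 := by
    rcases j with _ | j
    · exact hj rfl
    · have := dvd_sub k1.2 k2.2
      rw [Prod.snd_sub, hsub, sub_mul, sub_sub_cancel, leading, hsm, h0, h1, smul_mul_assoc] at this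
      refine hconst β (a * i + b * (j + 1)) ?_
      convert this using 1
      rw [mul_smul_comm, hij, Nat.add_sub_cancel]
      congr 1
      ring
  have hz : leading i j α β = 0 := by
    rw [hα, hβ]; simp only [leading, zero_smul]; rfl
  rw [hz, sub_zero] at hω
  exact hnot hω

end PowerSeries

/-! ### Increasing semimodules and their critical orders -/

/-- The semimodule generated by `lam 0, …, lam k` is increasing: each generator is larger than the
previous axis. -/
structure IncreasingUpTo (n m : ℕ) (lam : ℕ → ℕ) (k : ℕ) : Prop where
  coprime : n.Coprime m
  two_le : 2 ≤ n
  lt : n < m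
  zero : lam 0 = n
  one : lam 1 = m
  pos : 1 ≤ k
  indep : ∀ l, l ≤ k → lam l ∉ generated n m lam l
  axis_lt_lam : ∀ l, 1 ≤ l → l < k → axis n m lam l < lam (l + 1)

namespace IncreasingUpTo

variable {n m : ℕ} {lam : ℕ → ℕ} {k : ℕ}

theorem notch (h : IncreasingUpTo n m lam k) {l : ℕ} (hl : 1 ≤ l) (hlk : l ≤ k) :
    Notch n m (generated n m lam l) (lam l) (axis n m lam l) (coaxis n m lam l) := by
  obtain ⟨l, rfl⟩ := Nat.exists_eq_add_of_le' hl
  exact notch_coaxis h.coprime h.two_le h.lt h.zero h.one l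
    (fun j hj => h.indep j (by omega)) fun j hj hj' => h.axis_lt_lam j hj (by omega)

theorem lam_le_axis (h : IncreasingUpTo n m lam k) {l : ℕ} (hlk : l ≤ k) :
    lam l ≤ axis n m lam l := by
  rcases Nat.eq_zero_or_pos l with rfl | hl
  · exact le_rfl
  · exact le_of_mem_translate (h.notch hl hlk).mem_translate

theorem axis_lt_coaxis (h : IncreasingUpTo n m lam k) {j : ℕ} (hj : 1 ≤ j) (hjk : j ≤ k) :
    axis n m lam k < coaxis n m lam j :=
  (h.notch h.pos le_rfl).lt.trans_le (coaxis_le (fun _ hl => h.lam_le_axis hl) hj hjk)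

theorem axis_lt_mul (h : IncreasingUpTo n m lam k) : axis n m lam k < n * m :=
  (h.notch h.pos le_rfl).lt.trans_le (h.notch h.pos le_rfl).le

theorem crit_succ (h : IncreasingUpTo n m lam k) {l : ℕ} (hl : 1 ≤ l) (hlk : l ≤ k) :
    crit n m lam (l + 1) + lam l = crit n m lam l + axis n m lam l := by
  have h1 := h.lam_le_axis hlk
  obtain ⟨l, rfl⟩ := Nat.exists_eq_add_of_le' hl
  rw [crit]
  omega

theorem axis_one (h : IncreasingUpTo n m lam k) : axis n m lam 1 = n + m := by
  have hN := h.notch le_rfl h.pos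
  refine le_antisymm ?_ ?_
  · rw [← hN.sInf_eq]
    refine Nat.sInf_le ⟨⟨0, one_pos, 0, 1, ?_⟩, 1, 0, ?_⟩
    · rw [h.zero]; ring
    · rw [h.one]; ring
  · obtain ⟨a, b, e⟩ := hN.mem_translate
    obtain ⟨l, hl, a', b', e'⟩ := hN.mem
    obtain rfl : l = 0 := by omega
    rw [h.one] at e
    rw [h.zero] at e'
    rcases Nat.eq_zero_or_pos b' with rfl | hb
    · rcases Nat.eq_zero_or_pos a with rfl | ha
      · have e2 : (a' + 1) * n = (b + 1) * m := by nlinarith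
        have h3 : n ≤ b + 1 := by
          by_contra hc
          have := eq_zero_of_mul_eq_mul h.coprime (not_le.1 hc) e2
          omega
        nlinarith [h.two_le, h.lt]
      · nlinarith
    · nlinarith

theorem crit_two (h : IncreasingUpTo n m lam k) : crit n m lam 2 = n + m := by
  have h1 := h.crit_succ le_rfl h.pos
  rw [h.axis_one, h.one, crit] at h1
  simp only [Nat.reduceAdd] at h1
  omega

/-- The excess λ_j - t_j is 0 for j = 0, 1 and then strictly increases: λ_{j+1} - t_{j+1} > u_j -
t_{j+1} = λ_j - t_j. -/
theorem lam_add_crit_lt (h : IncreasingUpTo n m lam k) {l j : ℕ} (hlj : l < j) (hj : 2 ≤ j)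
    (hjk : j ≤ k) : lam l + crit n m lam j < lam j + crit n m lam l := by
  induction j, hj using Nat.le_induction generalizing l with
  | base =>
    have h1 := h.axis_lt_lam 1 le_rfl (by omega)
    rw [h.axis_one] at h1
    rw [h.crit_two]
    have h2 : lam l = crit n m lam l := by
      obtain rfl | rfl : l = 0 ∨ l = 1 := by omega
      · rw [h.zero, crit]
      · rw [h.one, crit]
    change n + m < lam 2 at h1
    omega
  | succ j hj ih =>
    have h1 := h.axis_lt_lam j (by omega) (by omega)
    have h2 := h.crit_succ (l := j) (by omega) (by omega)
    rcases Nat.lt_succ_iff_lt_or_eq.1 hlj with h3 | rfl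
    · have := ih h3 (by omega)
      omega
    · omega

theorem lam_add_crit_le (h : IncreasingUpTo n m lam k) {l j : ℕ} (hlj : l ≤ j) (hjk : j ≤ k) :
    lam l + crit n m lam j ≤ lam j + crit n m lam l := by
  rcases hlj.eq_or_lt with rfl | hlt
  · exact le_rfl
  rcases Nat.lt_or_ge j 2 with hj | hj
  · obtain rfl : l = 0 := by omega
    obtain rfl : j = 1 := by omega
    rw [h.zero, h.one, crit, crit]
    omega
  · exact (h.lam_add_crit_lt hlt hj hjk).le

theorem crit_le_lam (h : IncreasingUpTo n m lam k) {j : ℕ} (hjk : j ≤ k) :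
    crit n m lam j ≤ lam j := by
  have := h.lam_add_crit_le (Nat.zero_le j) hjk
  rw [h.zero, crit] at this
  omega

theorem crit_succ_le_axis (h : IncreasingUpTo n m lam k) :
    crit n m lam (k + 1) ≤ axis n m lam k := by
  have := h.crit_succ h.pos le_rfl
  have := h.crit_le_lam le_rfl
  omega

theorem crit_mem_translate (h : IncreasingUpTo n m lam k) {j : ℕ} (hj : 2 ≤ j) (hjk : j ≤ k + 1) :
    crit n m lam j ∈ translate n m (n + m) := by
  induction j, hj using Nat.le_induction with
  | base => rw [h.crit_two]; exact self_mem_translate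
  | succ j hj ih =>
    obtain ⟨a, b, e⟩ := (h.notch (l := j) (by omega) (by omega)).mem_translate
    have := h.crit_succ (l := j) (by omega) (by omega)
    exact translate_trans (ih (by omega)) ⟨a, b, by omega⟩

theorem mem_generated_of_mem_translate (h : IncreasingUpTo n m lam k) {j q : ℕ} (hj : 2 ≤ j)
    (hq : q ∈ translate n m (n + m)) : q ∈ generated n m lam j := by
  obtain ⟨a, b, rfl⟩ := hq
  exact ⟨0, by omega, a, b + 1, by rw [h.zero]; ring⟩

/-- Gaps lie below nm, the range where resonant parts are unique. -/
theorem lt_mul_of_notMem (h : IncreasingUpTo n m lam k) {j p : ℕ} (hj : 2 ≤ j)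
    (hp : p ∉ generated n m lam j) : p < n * m := by
  have hN := h.notch le_rfl h.pos
  have hp2 : p ∉ generated n m lam (1 + 1) := fun hc => hp (generated_mono hj hc)
  rw [mem_generated_succ, not_or] at hp2
  have hle : axis n m lam 1 < n * m := hN.lt.trans_le hN.le
  by_contra hc
  obtain ⟨a, b, e⟩ := hN.gap p hp2.1 hp2.2 (by omega)
  have := hN.le
  have := h.two_le
  have : 0 < (a + 1) * n := by positivity
  omega

end IncreasingUpTo

/-! ### Orders and values of sums -/

theorem sub_smul_eq (c : ℂ) (η ζ : OneForm) : η - c • ζ = η + (-c) • ζ := by module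

theorem wOrder_add_of_lt {n m : ℕ} {η ζ : OneForm} (h : wOrder n m η < wOrder n m ζ) :
    wOrder n m (η + ζ) = wOrder n m η := by
  refine le_antisymm ?_ ((le_min le_rfl h.le).trans (min_wOrder_le_add n m η ζ))
  have h1 := min_wOrder_le_add n m (η + ζ) ((-1 : ℂ) • ζ)
  have h0 : η + ζ + (-1 : ℂ) • ζ = η := by module
  rw [wOrder_smul n m (by norm_num), h0] at h1
  rcases min_le_iff.1 h1 with h2 | h2
  · exact h2
  · exact absurd h2 (not_le.2 h)

theorem lt_wOrder_add {n m : ℕ} {η ζ : OneForm} {p : ℕ∞} (h : p < wOrder n m η)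
    (h' : p < wOrder n m ζ) : p < wOrder n m (η + ζ) :=
  (lt_min h h').trans_le (min_wOrder_le_add n m η ζ)

theorem lt_wOrder_smul {n m : ℕ} {η : OneForm} {p : ℕ∞} (c : ℂ) (h : p < wOrder n m η) :
    p < wOrder n m (c • η) := h.trans_le (le_wOrder_smul n m c η)

theorem xy_zero_zero : xy 0 0 = 1 := by
  refine Subtype.ext ?_
  rw [coe_xy, expo, Finsupp.single_zero, Finsupp.single_zero, add_zero]
  rfl

theorem wOrder_zero (n m : ℕ) : wOrder n m 0 = ⊤ := by
  simp [wOrder]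

theorem wOrder_eq_min (n m : ℕ) (η : OneForm) :
    wOrder n m η = min (wOrder n m (η.1 • dx)) (wOrder n m (η.2 • dy)) := by
  simp [wOrder, dx, dy]

theorem eq_smul_dx_add_smul_dy (η : OneForm) : η = η.1 • dx + η.2 • dy := by
  ext <;> simp [dx, dy]

theorem wOrder_dx (n m : ℕ) : wOrder n m dx = n := by
  simp [wOrder, dx]

theorem wOrder_dy (n m : ℕ) : wOrder n m dy = m := by
  simp [wOrder, dy]

namespace ECusp

variable (K : ECusp)

theorem le_nu_smul (c : ℂ) (η : OneForm) : K.nu η ≤ K.nu (c • η) := by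
  rw [nu_eq, nu_eq, pull_smul]
  exact PowerSeries.le_order_smul

theorem nu_add_of_lt {η ζ : OneForm} (h : K.nu η < K.nu ζ) : K.nu (η + ζ) = K.nu η := by
  rw [nu_eq, nu_eq] at h
  rw [nu_eq, pull_add, PowerSeries.order_add_of_order_ne _ _ h.ne]
  exact min_eq_left h.le

theorem lt_nu_add {η ζ : OneForm} {p : ℕ∞} (h : p < K.nu η) (h' : p < K.nu ζ) :
    p < K.nu (η + ζ) := (lt_min h h').trans_le (K.min_nu_le_add η ζ)

theorem nu_sub_smul_left {η ζ : OneForm} (c : ℂ) (h : K.nu η < K.nu ζ) :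
    K.nu (η - c • ζ) = K.nu η := by
  rw [sub_smul_eq]
  exact K.nu_add_of_lt (h.trans_le (K.le_nu_smul _ _))

theorem nu_sub_smul_right {η ζ : OneForm} {c : ℂ} (hc : c ≠ 0) (h : K.nu ζ < K.nu η) :
    K.nu (η - c • ζ) = K.nu ζ := by
  rw [sub_smul_eq, add_comm, K.nu_add_of_lt, K.nu_smul (neg_ne_zero.2 hc)]
  rwa [K.nu_smul (neg_ne_zero.2 hc)]

theorem lt_nu_sub_smul {η ζ : OneForm} {p : ℕ∞} (c : ℂ) (h : p < K.nu η) (h' : p < K.nu ζ) :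
    p < K.nu (η - c • ζ) := by
  rw [sub_smul_eq]
  exact K.lt_nu_add h (h'.trans_le (K.le_nu_smul _ _))

theorem nu_dx : K.nu dx = K.S.n := by
  obtain ⟨x₀, y₀, hx, -, hc⟩ := K.exists_coeff_pull_leading
  refine le_antisymm ?_ ((wOrder_dx _ _).ge.trans (K.wOrder_le_nu dx))
  have h : leading 1 0 1 0 = dx := by
    simp only [leading, dx, zero_smul, one_smul, Nat.sub_self, xy_zero_zero]
  have h1 := hc 1 0 1 0 (by norm_num) (by norm_num)
  rw [h, one_mul, zero_mul, add_zero] at h1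
  refine PowerSeries.order_le _ ?_
  change PowerSeries.coeff K.S.n (K.pull dx) ≠ 0
  rw [h1]
  simp [hx, K.S.n_pos.ne']

theorem nu_dy : K.nu dy = K.S.m := by
  obtain ⟨x₀, y₀, -, hy, hc⟩ := K.exists_coeff_pull_leading
  refine le_antisymm ?_ ((wOrder_dy _ _).ge.trans (K.wOrder_le_nu dy))
  have h : leading 0 1 0 1 = dy := by
    simp only [leading, dy, zero_smul, one_smul, Nat.sub_self, xy_zero_zero]
  have h1 := hc 0 1 0 1 (by norm_num) (by norm_num)
  rw [h, one_mul, zero_mul, zero_add] at h1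
  refine PowerSeries.order_le _ ?_
  change PowerSeries.coeff K.S.m (K.pull dy) ≠ 0
  rw [h1]
  simp [hy, K.S.m_pos.ne']

/-! ### Induction along the basis -/

variable {K} {lam : ℕ → ℕ} {ω : ℕ → OneForm} {k : ℕ}

/-- Forms whose differential value is not among the values generated by the first `k` elements
of the basis have a large divisorial order. -/
def OrdersIn (K : ECusp) (lam : ℕ → ℕ) (k : ℕ) : Prop :=
  ∀ (η : OneForm) (p : ℕ), K.nu η = p → p ∉ generated K.S.n K.S.m lam k →
    ∃ a b, wOrder K.S.n K.S.m η = (crit K.S.n K.S.m lam k + (a * K.S.n + b * K.S.m) : ℕ)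

/-- The differential values and the divisorial orders of the forms whose values are not among those
generated by the first `k` elements of the basis are controlled by those of the next basis form. -/
def ValuesIn (K : ECusp) (lam : ℕ → ℕ) (k : ℕ) : Prop :=
  ∀ (η : OneForm) (p : ℕ), K.nu η = p → p ∉ generated K.S.n K.S.m lam k →
    ∃ a b, wOrder K.S.n K.S.m η = (crit K.S.n K.S.m lam k + (a * K.S.n + b * K.S.m) : ℕ) ∧
      lam k + (a * K.S.n + b * K.S.m) ≤ p

/-- If x^a y^b ζ had value above p, subtracting a multiple of it from η would keep the value p and
raise the weighted order; induction then bounds ν(ζ) with a larger shift, a contradiction. `N`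
bounds the distance from the weighted order to p, and distance 0 is excluded because t_{k+1} + Γ
lies in G_{k+1}. -/
theorem nu_add_le_of_ordersIn (hI : IncreasingUpTo K.S.n K.S.m lam k)
    (hP : OrdersIn K lam (k + 1)) {ζ : OneForm}
        (hζ : wOrder K.S.n K.S.m ζ = crit K.S.n K.S.m lam (k + 1))
    (N : ℕ) {η : OneForm} {p a b : ℕ} (hη : K.nu η = p)
    (hp : p ∉ generated K.S.n K.S.m lam (k + 1))
    (ho : wOrder K.S.n K.S.m η = (crit K.S.n K.S.m lam (k + 1) + (a * K.S.n + b * K.S.m) : ℕ))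
    (hN : p ≤ crit K.S.n K.S.m lam (k + 1) + (a * K.S.n + b * K.S.m) + N) :
    (a * K.S.n + b * K.S.m : ℕ) + K.nu ζ ≤ p := by
  induction N generalizing η a b with
  | zero =>
    exfalso
    have h1 : crit K.S.n K.S.m lam (k + 1) + (a * K.S.n + b * K.S.m) ≤ p := by
      have := K.wOrder_le_nu η
      rw [ho, hη] at this
      exact_mod_cast this
    have h2 : p = crit K.S.n K.S.m lam (k + 1) + (a * K.S.n + b * K.S.m) := by omega
    refine hp (hI.mem_generated_of_mem_translate (by have := hI.pos; omega) ?_)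
    rw [h2]
    exact translate_trans (hI.crit_mem_translate (by have := hI.pos; omega) le_rfl) ⟨a, b, rfl⟩
  | succ N ih =>
    by_contra hc
    rw [not_le, ← K.nu_xy_smul] at hc
    have hpm := hI.lt_mul_of_notMem (by have := hI.pos; omega) hp
    have h1 : crit K.S.n K.S.m lam (k + 1) + (a * K.S.n + b * K.S.m) ≤ p := by
      have := K.wOrder_le_nu η
      rw [ho, hη] at this
      exact_mod_cast this
    have h2 : crit K.S.n K.S.m lam (k + 1) + (a * K.S.n + b * K.S.m) ≠ p := by
      rintro rfl
      refine hp (hI.mem_generated_of_mem_translate (by have := hI.pos; omega) ?_)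
      exact translate_trans (hI.crit_mem_translate (by have := hI.pos; omega) le_rfl) ⟨a, b, rfl⟩
    have h3 : wOrder K.S.n K.S.m (xy a b • ζ) =
        (crit K.S.n K.S.m lam (k + 1) + (a * K.S.n + b * K.S.m) : ℕ) := by
      rw [wOrder_xy_smul, hζ, ← Nat.cast_add, Nat.add_comm]
    have h4 : ((crit K.S.n K.S.m lam (k + 1) + (a * K.S.n + b * K.S.m) : ℕ) : ℕ∞) < p := by
      exact_mod_cast lt_of_le_of_ne h1 h2
    obtain ⟨c, hc0, hlt⟩ := K.exists_wOrder_sub_lt (lt_of_le_of_lt h1 hpm) ho (by rwa [hη]) h3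
      (h4.trans hc)
    have h5 : K.nu (η - c • xy a b • ζ) = p := by
      rw [K.nu_sub_smul_left c (by rwa [hη]), hη]
    obtain ⟨a', b', ho'⟩ := hP _ p h5 hp
    rw [ho', Nat.cast_lt] at hlt
    have h6 := ih h5 ho' (by omega)
    rw [K.nu_xy_smul] at hc
    have h7 : ((a * K.S.n + b * K.S.m : ℕ) : ℕ∞) ≤ (a' * K.S.n + b' * K.S.m : ℕ) := by
      rw [Nat.cast_le]; omega
    exact absurd (h6.trans_lt hc) (not_lt.2 (add_le_add_left h7 _))

/-- The axis is a common value of monomial multiples of ω_k and an earlier ω_l. For k ≥ 2 the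
multiple of ω_l has the larger weighted order, so that of ω_k survives. -/
theorem exists_syzygy (hI : IncreasingUpTo K.S.n K.S.m lam k) (h0 : ω 0 = dx) (h1 : ω 1 = dy)
    (hν : ∀ l, l ≤ k → K.nu (ω l) = lam l)
    (ho : ∀ l, l ≤ k → wOrder K.S.n K.S.m (ω l) = crit K.S.n K.S.m lam l) :
    ∃ (l a b a' b' : ℕ) (c : ℂ), l < k ∧ c ≠ 0 ∧
      axis K.S.n K.S.m lam k = lam k + (a * K.S.n + b * K.S.m) ∧
      axis K.S.n K.S.m lam k = lam l + (a' * K.S.n + b' * K.S.m) ∧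
      (axis K.S.n K.S.m lam k : ℕ∞) < K.nu (xy a b • ω k - c • xy a' b' • ω l) ∧
      wOrder K.S.n K.S.m (xy a b • ω k - c • xy a' b' • ω l) = crit K.S.n K.S.m lam (k + 1) := by
  have hN := hI.notch hI.pos le_rfl
  obtain ⟨a, b, e⟩ := hN.mem_translate
  obtain ⟨l, hl, a', b', e'⟩ := hN.mem
  have n1 : K.nu (xy a b • ω k) = axis K.S.n K.S.m lam k := by
    rw [K.nu_xy_smul, hν k le_rfl, e, ← Nat.cast_add, Nat.add_comm]
  have n2 : K.nu (xy a' b' • ω l) = axis K.S.n K.S.m lam k := by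
    rw [K.nu_xy_smul, hν l hl.le, e', ← Nat.cast_add, Nat.add_comm]
  obtain ⟨c, hc, hlt⟩ := K.exists_nu_sub_lt n1 n2
  refine ⟨l, a, b, a', b', c, hl, hc, e, e', hlt, ?_⟩
  have hs := hI.crit_succ hI.pos le_rfl
  have o1 : wOrder K.S.n K.S.m (xy a b • ω k) = crit K.S.n K.S.m lam (k + 1) := by
    rw [wOrder_xy_smul, ho k le_rfl, ← Nat.cast_add, Nat.cast_inj]; omega
  have o2 : wOrder K.S.n K.S.m (xy a' b' • ω l) =
      (crit K.S.n K.S.m lam l + (a' * K.S.n + b' * K.S.m) : ℕ) := by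
    rw [wOrder_xy_smul, ho l hl.le, ← Nat.cast_add, Nat.add_comm]
  rcases Nat.lt_or_ge k 2 with hk | hk
  -- Here both terms have the same weighted order n + m, but one involves only dx and the other only
  -- dy, so nothing cancels.
  · have hk1 : k = 1 := by have := hI.pos; omega
    subst hk1
    obtain rfl : l = 0 := by omega
    have o3 : wOrder K.S.n K.S.m (xy a' b' • ω 0) = crit K.S.n K.S.m lam 2 := by
      rw [o2, Nat.cast_inj, hI.crit_two, ← hI.axis_one, e', hI.zero, crit]
    have e1 : xy a b • ω 1 - c • xy a' b' • ω 0 = ((-c) • xy a' b', xy a b) := by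
      rw [h0, h1]
      ext <;> simp [dx, dy]
    rw [e1, wOrder_eq_min, smul_assoc, wOrder_smul _ _ (neg_ne_zero.2 hc)]
    rw [h0] at o3
    rw [h1] at o1
    rw [o1, o3, min_self]
  · have h2 := hI.lam_add_crit_lt hl hk le_rfl
    rw [sub_smul_eq, wOrder_add_of_lt]
    · exact o1
    · rw [wOrder_smul _ _ (neg_ne_zero.2 hc)]
      rw [o1, o2, Nat.cast_lt]
      omega

/-- While the value lies in G_{k+1}, it is raised by subtracting a monomial multiple of some ω_l.
Since λ_l - t_l ≤ λ_k - t_k and the value exceeds u_k, these corrections have weighted order above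
t_{k+1}. `M` bounds how far the value is from `N`. -/
theorem exists_reduction (hI : IncreasingUpTo K.S.n K.S.m lam k)
    (hν : ∀ l, l ≤ k → K.nu (ω l) = lam l)
    (ho : ∀ l, l ≤ k → wOrder K.S.n K.S.m (ω l) = crit K.S.n K.S.m lam l) (N M : ℕ) {η : OneForm}
    (hη : (axis K.S.n K.S.m lam k : ℕ∞) < K.nu η) (hM : (N : ℕ∞) ≤ K.nu η + M) :
    ∃ ρ : OneForm, (crit K.S.n K.S.m lam (k + 1) : ℕ∞) < wOrder K.S.n K.S.m ρ ∧
      ((N : ℕ∞) ≤ K.nu (η + ρ) ∨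
        ∃ p : ℕ, K.nu (η + ρ) = p ∧ p ∉ generated K.S.n K.S.m lam (k + 1)) := by
  have ztop : ((crit K.S.n K.S.m lam (k + 1) : ℕ) : ℕ∞) < wOrder K.S.n K.S.m 0 := by
    rw [wOrder_zero]; exact ENat.natCast_lt_top _
  induction M generalizing η with
  | zero => exact ⟨0, ztop, Or.inl (by simpa using hM)⟩
  | succ M ih =>
    by_cases h1 : (N : ℕ∞) ≤ K.nu η
    · exact ⟨0, ztop, Or.inl (by simpa using h1)⟩
    obtain ⟨p, hp⟩ := ENat.ne_top_iff_exists.1 (ne_top_of_lt (not_le.1 h1))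
    by_cases h2 : p ∈ generated K.S.n K.S.m lam (k + 1)
    · obtain ⟨l, hl, a, b, e⟩ := h2
      have hlk : l ≤ k := Nat.lt_succ_iff.1 hl
      have n2 : K.nu (xy a b • ω l) = p := by
        rw [K.nu_xy_smul, hν l hlk, e, ← Nat.cast_add, Nat.add_comm]
      obtain ⟨c, hc, hlt⟩ := K.exists_nu_sub_lt hp.symm n2
      rw [← hp, Nat.cast_lt] at hη
      obtain ⟨ρ, hρ, hρ'⟩ := ih (η := η - c • xy a b • ω l)
        (lt_trans (by exact_mod_cast hη) hlt) (by
          have : ((p + 1 : ℕ) : ℕ∞) ≤ K.nu (η - c • xy a b • ω l) := by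
            push_cast
            exact Order.add_one_le_of_lt hlt
          refine le_trans ?_ (add_le_add_left this (M : ℕ∞))
          rw [← hp] at hM
          refine hM.trans (le_of_eq ?_)
          push_cast
          ring)
      refine ⟨(-c) • xy a b • ω l + ρ, lt_wOrder_add (lt_wOrder_smul _ ?_) hρ, ?_⟩
      · rw [wOrder_xy_smul]
        have := ho l hlk
        rw [this, ← Nat.cast_add, Nat.cast_lt]
        have h3 := hI.lam_add_crit_le hlk le_rfl
        have h4 := hI.crit_succ hI.pos le_rfl
        omega
      · rwa [← add_assoc, ← sub_smul_eq]
    · exact ⟨0, ztop, Or.inr ⟨p, by rw [add_zero, hp], h2⟩⟩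

/-- The reduced syzygy ζ has weighted order t_{k+1} and value at least λ_{k+1}. Comparison with ζ
forces ω_{k+1} to have weighted order t_{k+1}; comparison with ω_{k+1} itself then gives `ValuesIn`.
-/
theorem ord_eq_and_valuesIn {s : ℕ} (hω : IsExtendedStandardBasis K s lam ω) (hk : k ≤ s)
    (hI : IncreasingUpTo K.S.n K.S.m lam k)
    (ho : ∀ l, l ≤ k → wOrder K.S.n K.S.m (ω l) = crit K.S.n K.S.m lam l)
        (hP : OrdersIn K lam (k + 1)) :
    wOrder K.S.n K.S.m (ω (k + 1)) = crit K.S.n K.S.m lam (k + 1) ∧ ValuesIn K lam (k + 1) := by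
  have hν : ∀ l, l ≤ k → K.nu (ω l) = lam l := fun l hl => hω.value l (by omega)
  have hcomp : ∀ {ζ : OneForm}, wOrder K.S.n K.S.m ζ = crit K.S.n K.S.m lam (k + 1) →
      ∀ (η : OneForm) (p : ℕ),
      K.nu η = p → p ∉ generated K.S.n K.S.m lam (k + 1) → ∃ a b,
        wOrder K.S.n K.S.m η = (crit K.S.n K.S.m lam (k + 1) + (a * K.S.n + b * K.S.m) : ℕ) ∧
        (a * K.S.n + b * K.S.m : ℕ) + K.nu ζ ≤ p := by
    intro ζ hζ η p hη hp
    obtain ⟨a, b, hab⟩ := hP η p hη hp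
    exact ⟨a, b, hab, nu_add_le_of_ordersIn hI hP hζ p hη hp hab (by omega)⟩
  obtain ⟨l, a, b, a', b', c, -, -, -, -, hη, hηo⟩ := exists_syzygy hI hω.first hω.second hν ho
  obtain ⟨ρ, hρ, hρ'⟩ := exists_reduction hI hν ho (lam (k + 1)) (lam (k + 1)) hη le_add_self
  have hζ : wOrder K.S.n K.S.m (xy a b • ω k - c • xy a' b' • ω l + ρ) =
      crit K.S.n K.S.m lam (k + 1) := by
    rw [wOrder_add_of_lt]
    · exact hηo
    · rwa [hηo]
  have hζν : (lam (k + 1) : ℕ∞) ≤ K.nu (xy a b • ω k - c • xy a' b' • ω l + ρ) := by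
    rcases hρ' with h | ⟨p, hp, hp'⟩
    · exact h
    · rw [hp, Nat.cast_le]
      have hmem : p ∈ K.semimodule := ⟨_, hp⟩
      rw [hω.basis.generates] at hmem
      obtain ⟨j, hj, hj'⟩ := hmem
      have hkj : k + 1 ≤ j := by
        by_contra hc
        exact hp' ⟨j, by omega, hj'⟩
      refine le_trans ?_ (le_of_mem_translate hj')
      rcases hkj.eq_or_lt with rfl | hlt
      · exact le_rfl
      · exact (hω.basis.increasing _ _ hlt (by omega)).le
  have hval := hω.value (k + 1) (by omega)
  have hord : wOrder K.S.n K.S.m (ω (k + 1)) = crit K.S.n K.S.m lam (k + 1) := by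
    obtain ⟨a, b, hab, hle⟩ := hcomp hζ _ _ hval (hω.basis.independent _ (by omega))
    -- The shift an + bm of the weighted order of ω_{k+1} must be zero.
    have h1 : ((a * K.S.n + b * K.S.m : ℕ) : ℕ∞) + lam (k + 1) ≤ lam (k + 1) :=
      (add_le_add_right hζν _).trans hle
    rw [← Nat.cast_add, Nat.cast_le] at h1
    rw [hab, Nat.cast_inj]
    omega
  refine ⟨hord, fun η p hη hp => ?_⟩
  obtain ⟨a, b, hab, hle⟩ := hcomp hord η p hη hp
  rw [hval, ← Nat.cast_add, Nat.cast_le] at hle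
  exact ⟨a, b, hab, by omega⟩

/-- A value outside G_2 cannot equal the weighted order, so the leading part is resonant and its
weight lies in n + m + Γ. -/
theorem ordersIn_two (hI : IncreasingUpTo K.S.n K.S.m lam 1) {η : OneForm} {p : ℕ}
    (hη : K.nu η = p) (hp : p ∉ generated K.S.n K.S.m lam 2) :
    (∃ a b, wOrder K.S.n K.S.m η = (crit K.S.n K.S.m lam 2 + (a * K.S.n + b * K.S.m) : ℕ)) ∧
      axis K.S.n K.S.m lam 1 < p := by
  have hle := K.wOrder_le_nu η
  rw [hη] at hle
  obtain ⟨q, hq⟩ := ENat.ne_top_iff_exists.1 (ne_top_of_le_ne_top (ENat.natCast_ne_top p) hle)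
  rw [← hq, Nat.cast_le] at hle
  have hpm := hI.lt_mul_of_notMem le_rfl hp
  have hqp : q ≠ p := by
    rintro rfl
    rcases exists_leading K.S.coprime hpm hq.le with h | ⟨a, b, α, β, hab, ha, hb, h⟩
    · rw [← hq, Nat.cast_le] at h; omega
    · rcases Nat.eq_zero_or_pos a with rfl | h1
      · rcases Nat.eq_zero_or_pos b with rfl | h2
        · have hz : leading 0 0 α β = 0 := by
            rw [ha rfl, hb rfl]; simp only [leading, zero_smul]; rfl
          rw [hz, sub_zero, ← hq, Nat.cast_le] at h
          omega
        · obtain ⟨b, rfl⟩ := Nat.exists_eq_add_of_le' h2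
          exact hp ⟨1, by omega, 0, b, by rw [hI.one, hab]; ring⟩
      · obtain ⟨a, rfl⟩ := Nat.exists_eq_add_of_le' h1
        exact hp ⟨0, by omega, a, b, by rw [hI.zero, hab]; ring⟩
  have hlt : q < p := lt_of_le_of_ne hle hqp
  obtain ⟨a, b, e⟩ := K.mem_translate_of_resonant (hlt.trans hpm) hq.symm
    (by rw [hη]; exact_mod_cast hlt)
  refine ⟨⟨a, b, ?_⟩, ?_⟩
  · rw [← hq, Nat.cast_inj, hI.crit_two, e]
  · rw [hI.axis_one]; omega

/-- Eliminating the leading part of η with x^a y^b ω_j yields a form of value λ_j + an + bm but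
weighted order above t_j + an + bm. By `ValuesIn` such a value cannot lie outside G_j. -/
theorem mem_generated_of_lt_nu (hI : IncreasingUpTo K.S.n K.S.m lam k) {j : ℕ} (hj : 2 ≤ j)
    (hjk : j ≤ k) (hν : K.nu (ω j) = lam j)
    (ho : wOrder K.S.n K.S.m (ω j) = crit K.S.n K.S.m lam j)
    (hV : ValuesIn K lam j) {η : OneForm} {a b : ℕ}
    (hη : wOrder K.S.n K.S.m η = (crit K.S.n K.S.m lam j + (a * K.S.n + b * K.S.m) : ℕ))
    (hlt : ((lam j + (a * K.S.n + b * K.S.m) : ℕ) : ℕ∞) < K.nu η)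
    (hm : crit K.S.n K.S.m lam j + (a * K.S.n + b * K.S.m) < K.S.n * K.S.m) :
    lam j + (a * K.S.n + b * K.S.m) ∈ generated K.S.n K.S.m lam j := by
  by_contra hq
  have hcl : crit K.S.n K.S.m lam j < lam j := by
    have := hI.lam_add_crit_lt (l := 0) (by omega) hj hjk
    rw [hI.zero, crit] at this
    omega
  have n1 : K.nu (xy a b • ω j) = (lam j + (a * K.S.n + b * K.S.m) : ℕ) := by
    rw [K.nu_xy_smul, hν, ← Nat.cast_add, Nat.add_comm]
  have o1 : wOrder K.S.n K.S.m (xy a b • ω j) =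
      (crit K.S.n K.S.m lam j + (a * K.S.n + b * K.S.m) : ℕ) := by
    rw [wOrder_xy_smul, ho, ← Nat.cast_add, Nat.add_comm]
  have h1 : ((crit K.S.n K.S.m lam j + (a * K.S.n + b * K.S.m) : ℕ) : ℕ∞) <
      (lam j + (a * K.S.n + b * K.S.m) : ℕ) := by
    rw [Nat.cast_lt]; omega
  obtain ⟨c, hc, hlt'⟩ := K.exists_wOrder_sub_lt hm hη (h1.trans hlt) o1 (by rwa [n1])
  have n2 := K.nu_sub_smul_right hc (n1.trans_lt hlt)
  rw [n1] at n2
  obtain ⟨a', b', hab, hle⟩ := hV _ _ n2 hq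
  rw [hab, Nat.cast_lt] at hlt'
  omega

theorem ordersIn_succ (hI : IncreasingUpTo K.S.n K.S.m lam k) (hk : 2 ≤ k)
    (hν : K.nu (ω k) = lam k) (ho : wOrder K.S.n K.S.m (ω k) = crit K.S.n K.S.m lam k)
    (hV : ValuesIn K lam k) {η : OneForm} {p : ℕ}
    (hη : K.nu η = p) (hp : p ∉ generated K.S.n K.S.m lam (k + 1)) :
    (∃ a b, wOrder K.S.n K.S.m η =
      (crit K.S.n K.S.m lam (k + 1) + (a * K.S.n + b * K.S.m) : ℕ)) ∧
      axis K.S.n K.S.m lam k < p := by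
  have hpm := hI.lt_mul_of_notMem (by omega) hp
  have hp' := hp
  rw [mem_generated_succ, not_or] at hp'
  obtain ⟨a, b, hab, hle⟩ := hV η p hη hp'.1
  have hne : lam k + (a * K.S.n + b * K.S.m) ≠ p := fun h => hp'.2 ⟨a, b, h.symm⟩
  have hlt : lam k + (a * K.S.n + b * K.S.m) < p := lt_of_le_of_ne hle hne
  have hN := hI.notch hI.pos le_rfl
  have hs := hI.crit_succ hI.pos le_rfl
  have hcl := hI.crit_le_lam le_rfl
  have hmem := mem_generated_of_lt_nu hI hk le_rfl hν ho hV hab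
    (by rw [hη]; exact_mod_cast hlt) (by omega)
  rcases hN.inter _ hmem mem_translate with ⟨a', b', e⟩ | h
  · exact ⟨⟨a', b', by rw [hab, Nat.cast_inj]; omega⟩, by omega⟩
  -- Beyond the second corner there is no gap, yet p would be one.
  · exfalso
    have := hN.lt
    obtain ⟨a', b', e⟩ := hN.gap p hp'.1 hp'.2 (by omega)
    omega

theorem increasingUpTo_one {s : ℕ} (hω : IsExtendedStandardBasis K s lam ω) :
    IncreasingUpTo K.S.n K.S.m lam 1 where
  coprime := K.S.coprime
  two_le := K.two_le_n
  lt := K.S.n_lt_m K.two_le_n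
  zero := by
    have := hω.value 0 (by omega)
    rw [hω.first, K.nu_dx, Nat.cast_inj] at this
    exact this.symm
  one := by
    have := hω.value 1 (by omega)
    rw [hω.second, K.nu_dy, Nat.cast_inj] at this
    exact this.symm
  pos := le_rfl
  indep l hl := hω.basis.independent l (by omega)
  axis_lt_lam l h1 h2 := by omega

theorem increasingUpTo_succ {s : ℕ} (hω : IsExtendedStandardBasis K s lam ω)
    (hI : IncreasingUpTo K.S.n K.S.m lam k) (hk : k ≤ s)
    (hlt : axis K.S.n K.S.m lam k < lam (k + 1)) : IncreasingUpTo K.S.n K.S.m lam (k + 1) where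
  coprime := hI.coprime
  two_le := hI.two_le
  lt := hI.lt
  zero := hI.zero
  one := hI.one
  pos := by omega
  indep l hl := hω.basis.independent l (by omega)
  axis_lt_lam l h1 h2 := by
    rcases Nat.lt_succ_iff_lt_or_eq.1 h2 with h3 | rfl
    · exact hI.axis_lt_lam l h1 h3
    · exact hlt

theorem increasingUpTo {s : ℕ} (hω : IsExtendedStandardBasis K s lam ω) (h1 : 1 ≤ k)
    (hk : k ≤ s + 1) : IncreasingUpTo K.S.n K.S.m lam k ∧
      (∀ l, l ≤ k → wOrder K.S.n K.S.m (ω l) = crit K.S.n K.S.m lam l) ∧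
      (2 ≤ k → ValuesIn K lam k) := by
  induction k, h1 using Nat.le_induction with
  | base =>
    refine ⟨increasingUpTo_one hω, fun l hl => ?_, fun h => by omega⟩
    obtain rfl | rfl : l = 0 ∨ l = 1 := by omega
    · rw [hω.first, wOrder_dx, crit]
    · rw [hω.second, wOrder_dy, crit]
  | succ k h1 ih =>
    obtain ⟨hI, ho, hV⟩ := ih (by omega)
    have key : ∀ {η : OneForm} {p : ℕ}, K.nu η = p → p ∉ generated K.S.n K.S.m lam (k + 1) →
        (∃ a b, wOrder K.S.n K.S.m η =
          (crit K.S.n K.S.m lam (k + 1) + (a * K.S.n + b * K.S.m) : ℕ)) ∧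
        axis K.S.n K.S.m lam k < p := by
      rcases h1.eq_or_lt with rfl | h2
      · exact ordersIn_two hI
      · exact ordersIn_succ hI h2 (hω.value k (by omega)) (ho k le_rfl) (hV h2)
    have hlt := (key (hω.value (k + 1) hk) (hω.basis.independent _ hk)).2
    obtain ⟨h3, h4⟩ := ord_eq_and_valuesIn hω (by omega) hI ho fun η p hη hp => (key hη hp).1
    refine ⟨increasingUpTo_succ hω hI (by omega) hlt, fun l hl => ?_, fun _ => h4⟩
    rcases hl.eq_or_lt with rfl | hl
    · exact h3
    · exact ho l (by omega)

end ECusp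

/-! ### Decompositions through the preceding forms -/

theorem sum_add_ite_smul (g : ℕ → Germ) (ω : ℕ → OneForm) (h : Germ) {j N : ℕ} (hj : j < N) :
    ∑ l ∈ Finset.range N, (g l + if l = j then h else 0) • ω l =
      ∑ l ∈ Finset.range N, g l • ω l + h • ω j := by
  simp [add_smul, ite_smul, Finset.sum_add_distrib, Finset.sum_ite_eq', hj]

theorem crit_mono {n m : ℕ} {lam : ℕ → ℕ} {k l : ℕ} (hk : 1 ≤ k) (hkl : k ≤ l) :
    crit n m lam k ≤ crit n m lam l := by
  induction l, hkl using Nat.le_induction with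
  | base => exact le_rfl
  | succ l hl ih =>
    obtain ⟨r, rfl⟩ := Nat.exists_eq_add_of_le' (hk.trans hl)
    refine ih.trans ?_
    rw [crit]
    omega

namespace ECusp

variable {K : ECusp} {lam : ℕ → ℕ} {ω : ℕ → OneForm} {k s : ℕ}

theorem nu_zero (K : ECusp) : K.nu 0 = ⊤ :=
  top_le_iff.1 ((wOrder_zero _ _).ge.trans (K.wOrder_le_nu 0))

theorem exists_sum_of_lt_wOrder (h0 : ω 0 = dx) (h1 : ω 1 = dy) (hk : 1 ≤ k) {p : ℕ}
    {η : OneForm} (hη : (p : ℕ∞) < wOrder K.S.n K.S.m η) :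
    ∃ g : ℕ → Germ, η = ∑ l ∈ Finset.range (k + 1), g l • ω l ∧
      ∀ l, l ≤ k → (p : ℕ∞) < K.nu (g l • ω l) := by
  refine ⟨fun l => (0 + if l = 0 then η.1 else 0) + if l = 1 then η.2 else 0, ?_, fun l _ => ?_⟩
  · rw [sum_add_ite_smul _ _ _ (by omega), sum_add_ite_smul (fun _ => 0) _ _ (by omega), h0, h1]
    simp only [zero_smul, Finset.sum_const_zero, zero_add]
    exact eq_smul_dx_add_smul_dy η
  · rw [wOrder_eq_min, lt_min_iff] at hη
    rcases l with _ | _ | l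
    · simpa [h0] using hη.1.trans_le (K.wOrder_le_nu _)
    · simpa [h1] using hη.2.trans_le (K.wOrder_le_nu _)
    · simp [K.nu_zero]

/-- Once the weighted order exceeds u_k, the splitting into dx and dy suffices. Until then the
leading part is resonant, and it is removed by a multiple of some ω_j whose value is already above
u_k. `N` bounds the remaining distance. -/
theorem exists_sum_of_lt (hω : IsExtendedStandardBasis K s lam ω) (h1 : 1 ≤ k) (hk : k ≤ s + 1)
    (N : ℕ) {η : OneForm} (hη : (axis K.S.n K.S.m lam k : ℕ∞) < K.nu η)
    (hηo : (crit K.S.n K.S.m lam (k + 1) : ℕ∞) < wOrder K.S.n K.S.m η)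
    (hN : (axis K.S.n K.S.m lam k : ℕ∞) < wOrder K.S.n K.S.m η + N) :
    ∃ g : ℕ → Germ, η = ∑ l ∈ Finset.range (k + 1), g l • ω l ∧
      ∀ l, l ≤ k → (axis K.S.n K.S.m lam k : ℕ∞) < K.nu (g l • ω l) := by
  obtain ⟨hI, ho, -⟩ := increasingUpTo hω h1 hk
  induction N generalizing η with
  | zero => exact exists_sum_of_lt_wOrder hω.first hω.second h1 (by simpa using hN)
  | succ N ih =>
    by_cases hlt : (axis K.S.n K.S.m lam k : ℕ∞) < wOrder K.S.n K.S.m η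
    · exact exists_sum_of_lt_wOrder hω.first hω.second h1 hlt
    rw [not_lt] at hlt
    obtain ⟨q, hq⟩ := ENat.ne_top_iff_exists.1 (ne_top_of_le_ne_top (ENat.natCast_ne_top _) hlt)
    rw [← hq, Nat.cast_le] at hlt
    have hqo := hηo
    rw [← hq, Nat.cast_lt] at hqo
    have hqm : q < K.S.n * K.S.m := hlt.trans_lt hI.axis_lt_mul
    have hqν : (q : ℕ∞) < K.nu η := lt_of_le_of_lt (by exact_mod_cast hlt) hη
    have hmem := K.mem_translate_of_resonant hqm hq.symm hqν
    rw [← hI.crit_two] at hmem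
    have hk2 : 2 ≤ k := by
      by_contra hc
      obtain rfl : k = 1 := by omega
      have := hI.crit_two
      have := hI.axis_one
      simp only [Nat.reduceAdd] at hqo
      omega
    classical
    -- The right ω_j is the last one, with j ≤ k, such that q lies in t_j + Γ.
    let P : ℕ → Prop := fun j => q ∈ translate K.S.n K.S.m (crit K.S.n K.S.m lam j)
    obtain ⟨j, hj2, hjk, ⟨a, b, e⟩, hmax⟩ : ∃ j, 2 ≤ j ∧ j ≤ k ∧ P j ∧ ∀ i, j < i → i ≤ k → ¬ P i :=
      ⟨Nat.findGreatest P k, Nat.le_findGreatest hk2 hmem, Nat.findGreatest_le k,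
        Nat.findGreatest_spec hk2 hmem, fun i hi hik => Nat.findGreatest_is_greatest hi hik⟩
    have hνj := hω.value j (by omega)
    have hoj := ho j hjk
    have hs := hI.crit_succ (by omega : 1 ≤ j) hjk
    have hp : axis K.S.n K.S.m lam k < lam j + (a * K.S.n + b * K.S.m) := by
      rcases hjk.eq_or_lt with rfl | hjk'
      · omega
      by_contra hc
      rw [not_lt] at hc
      have hg := mem_generated_of_lt_nu hI hj2 hjk hνj hoj
        ((increasingUpTo hω (by omega) (by omega)).2.2 hj2) (hq.symm.trans (congrArg _ e))
        (lt_of_le_of_lt (by exact_mod_cast hc) hη) (by omega)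
      -- Otherwise λ_j + an + bm is either in u_j + Γ, so that q is in t_{j+1} + Γ against
      -- maximality of j, or beyond the second corner at j, which exceeds u_k.
      have hNj := hI.notch (by omega : 1 ≤ j) hjk
      rcases hNj.inter _ hg mem_translate with ⟨a', b', e'⟩ | h
      · exact hmax (j + 1) (by omega) (by omega) ⟨a', b', by omega⟩
      · have := hI.axis_lt_coaxis (by omega : 1 ≤ j) hjk
        omega
    have n1 : K.nu (xy a b • ω j) = (lam j + (a * K.S.n + b * K.S.m) : ℕ) := by
      rw [K.nu_xy_smul, hνj, ← Nat.cast_add, Nat.add_comm]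
    have o1 : wOrder K.S.n K.S.m (xy a b • ω j) = q := by
      rw [wOrder_xy_smul, hoj, e, ← Nat.cast_add, Nat.add_comm]
    have n2 : (axis K.S.n K.S.m lam k : ℕ∞) < K.nu (xy a b • ω j) := by
      rw [n1]; exact_mod_cast hp
    obtain ⟨c, hc, hlt'⟩ := K.exists_wOrder_sub_lt hqm hq.symm hqν o1
      (lt_of_le_of_lt (by exact_mod_cast hlt) n2)
    obtain ⟨g, hg, hg'⟩ := ih (K.lt_nu_sub_smul c hη n2)
      (lt_trans (by exact_mod_cast hqo) hlt') (by
        rw [← hq] at hN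
        refine hN.trans_le ?_
        have := Order.add_one_le_of_lt hlt'
        refine le_trans (le_of_eq ?_) (add_le_add_left this (N : ℕ∞))
        push_cast
        ring)
    refine ⟨fun l => g l + if l = j then c • xy a b else 0, ?_, fun l hl => ?_⟩
    · rw [sum_add_ite_smul _ _ _ (by omega), ← hg, smul_assoc, sub_add_cancel]
    · dsimp only
      rcases eq_or_ne l j with rfl | hne
      · rw [if_pos rfl, add_smul, smul_assoc]
        exact K.lt_nu_add (hg' l hl) (n2.trans_le (K.le_nu_smul _ _))
      · rw [if_neg hne, add_zero]
        exact hg' l hl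

/-- The decomposition of each form of an extended standard basis through the preceding ones. -/
theorem exists_decomposition (hω : IsExtendedStandardBasis K s lam ω) (h1 : 1 ≤ k)
    (hk : k ≤ s + 1) : ∃ f : ℕ → Germ, ω (k + 1) = ∑ l ∈ Finset.range (k + 1), f l • ω l ∧
      (∀ l, l ≤ k → (axis K.S.n K.S.m lam k : ℕ∞) ≤ K.nu (f l • ω l)) ∧
      K.nu (f k • ω k) = axis K.S.n K.S.m lam k ∧
      ∃! l, l < k ∧ K.nu (f l • ω l) = axis K.S.n K.S.m lam k := by
  obtain ⟨hI, ho, -⟩ := increasingUpTo hω h1 hk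
  have hν : ∀ l, l ≤ k → K.nu (ω l) = lam l := fun l hl => hω.value l (by omega)
  have hca := hI.crit_succ_le_axis
  have ham := hI.axis_lt_mul
  obtain ⟨hωo, hων⟩ : wOrder K.S.n K.S.m (ω (k + 1)) = crit K.S.n K.S.m lam (k + 1) ∧
      (axis K.S.n K.S.m lam k : ℕ∞) < K.nu (ω (k + 1)) := by
    -- For the last form ω_{s+2} the weighted order comes from ν_E, as t_{s+2} ≤ u_{s+1} < nm; for
    -- the others both facts come from the induction.
    rcases hk.eq_or_lt with rfl | hlt
    · refine ⟨wOrder_eq_of_nuE (by omega) hω.order_last, ?_⟩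
      rw [hω.value_last]
      exact ENat.natCast_lt_top _
    · obtain ⟨hI', ho', -⟩ := increasingUpTo (k := k + 1) hω (by omega) (by omega)
      refine ⟨ho' _ le_rfl, ?_⟩
      rw [hω.value _ (by omega), Nat.cast_lt]
      exact hI'.axis_lt_lam k h1 (by omega)
  obtain ⟨j, a, b, a', b', c, hj, hc, e, e', hη, hηo⟩ := exists_syzygy hI hω.first hω.second hν ho
  have hca' : (crit K.S.n K.S.m lam (k + 1) : ℕ∞) ≤ axis K.S.n K.S.m lam k := by exact_mod_cast hca
  obtain ⟨c', hc', hlt⟩ := K.exists_wOrder_sub_lt (by omega) hωo (hca'.trans_lt hων) hηo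
    (hca'.trans_lt hη)
  obtain ⟨g, hg, hg'⟩ := exists_sum_of_lt hω h1 hk (axis K.S.n K.S.m lam k + 1)
    (K.lt_nu_sub_smul c' hων hη) hlt (lt_of_lt_of_le
      (by exact_mod_cast Nat.lt_succ_self _) le_add_self)
  have n1 : K.nu (c' • xy a b • ω k) = axis K.S.n K.S.m lam k := by
    rw [K.nu_smul hc', K.nu_xy_smul, hν k le_rfl, e, ← Nat.cast_add, Nat.add_comm]
  have n2 : K.nu ((-(c' * c)) • xy a' b' • ω j) = axis K.S.n K.S.m lam k := by
    rw [K.nu_smul (neg_ne_zero.2 (mul_ne_zero hc' hc)), K.nu_xy_smul, hν j hj.le, e',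
      ← Nat.cast_add, Nat.add_comm]
  -- The two monomial terms come from the syzygy and carry the value u_k; the `g l` only contribute
  -- values above it.
  let f : ℕ → Germ := fun l => (g l + if l = k then c' • xy a b else 0) +
    if l = j then (-(c' * c)) • xy a' b' else 0
  have fk : K.nu (f k • ω k) = axis K.S.n K.S.m lam k := by
    simp only [f, if_pos, if_neg hj.ne', add_zero]
    rw [add_smul, smul_assoc, add_comm, K.nu_add_of_lt, n1]
    rw [n1]
    exact hg' k le_rfl
  have fj : K.nu (f j • ω j) = axis K.S.n K.S.m lam k := by
    simp only [f, if_pos, if_neg hj.ne, add_zero]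
    rw [add_smul, smul_assoc, add_comm, K.nu_add_of_lt, n2]
    rw [n2]
    exact hg' j hj.le
  have fl : ∀ l, l ≤ k → l ≠ k → l ≠ j → (axis K.S.n K.S.m lam k : ℕ∞) < K.nu (f l • ω l) := by
    intro l hl h2 h3
    simp only [f, if_neg h2, if_neg h3, add_zero]
    exact hg' l hl
  refine ⟨f, ?_, fun l hl => ?_, fk, j, ⟨hj, fj⟩, ?_⟩
  · rw [sum_add_ite_smul _ _ _ (by omega), sum_add_ite_smul _ _ _ (by omega), ← hg, smul_assoc,
      smul_assoc]
    generalize xy a b • ω k = A, xy a' b' • ω j = B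
    module
  · rcases eq_or_ne l k with rfl | h2
    · exact fk.ge
    · rcases eq_or_ne l j with rfl | h3
      · exact fj.ge
      · exact (fl l hl h2 h3).le
  · rintro l ⟨hl, hl'⟩
    by_contra hne
    exact (fl l hl.le hl.ne hne).ne' hl'

end ECusp

end Delorme

end

/-! ### Descending induction on j -/

theorem mainTheorem2 (K : Delorme.ECusp) (s : ℕ) (lam : ℕ → ℕ) (ω : ℕ → Delorme.OneForm)
    (hω : Delorme.IsExtendedStandardBasis K s lam ω) (i j : ℕ) (hji : j ≤ i) (his : i ≤ s) :
    ∃ f : ℕ → Delorme.Germ,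
      ω (i + 2) = ∑ l ∈ Finset.range (j + 2), f l • ω l ∧
      (∀ l ≤ j + 1,
        (Delorme.vbound K.S.n K.S.m lam i j : ℕ∞) ≤ K.nu (f l • ω l)) ∧
      K.nu (f (j + 1) • ω (j + 1)) = Delorme.vbound K.S.n K.S.m lam i j ∧
      ∃! k : ℕ, k ≤ j ∧ K.nu (f k • ω k) = Delorme.vbound K.S.n K.S.m lam i j := by
  open Delorme in
  induction hji using Nat.decreasingInduction with
  | self =>
    obtain ⟨f, h1, h2, h3, h4⟩ := ECusp.exists_decomposition hω (k := i + 1) (by omega) (by omega)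
    have hv : vbound K.S.n K.S.m lam i i = axis K.S.n K.S.m lam (i + 1) := by
      have hI := (ECusp.increasingUpTo hω (k := i + 1) (by omega) (by omega)).1
      have h5 := hI.crit_succ hI.pos le_rfl
      have h6 := hI.lam_le_axis le_rfl
      rw [vbound]
      change crit _ _ _ (i + 2) + _ = _ at h5
      omega
    rw [hv]
    exact ⟨f, h1, h2, h3, by simpa only [Nat.lt_succ_iff] using h4⟩
  | of_succ j hj ih =>
    obtain ⟨f, f1, f2, f3, -⟩ := ih
    obtain ⟨g, g1, g2, g3, k, ⟨hk, gk⟩, huniq⟩ :=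
      ECusp.exists_decomposition hω (k := j + 1) (by omega) (by omega)
    have hI := (ECusp.increasingUpTo hω (k := j + 2) (by omega) (by omega)).1
    have hs : crit K.S.n K.S.m lam (j + 2) + lam (j + 1) =
      crit K.S.n K.S.m lam (j + 1) + axis K.S.n K.S.m lam (j + 1) :=
        hI.crit_succ (l := j + 1) (by omega) (by omega)
    have hlt : axis K.S.n K.S.m lam (j + 1) < lam (j + 2) :=
      hI.axis_lt_lam (j + 1) (by omega) (by omega)
    have hm1 : crit K.S.n K.S.m lam (j + 2) ≤ crit K.S.n K.S.m lam (i + 2) :=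
      crit_mono (by omega) (by omega)
    have hm2 : crit K.S.n K.S.m lam (j + 1) ≤ crit K.S.n K.S.m lam (j + 2) :=
      crit_mono (by omega) (by omega)
    have hv : vbound K.S.n K.S.m lam i j =
        (crit K.S.n K.S.m lam (i + 2) - crit K.S.n K.S.m lam (j + 2)) +
          axis K.S.n K.S.m lam (j + 1) := by
      rw [vbound]; omega
    -- This is the increasing property u_{j+1} < λ_{j+2}. It makes all terms of the previous
    -- expression of index at most j+1 negligible, so the two terms of exact value are those of the
    -- substituted decomposition.
    have hv' : vbound K.S.n K.S.m lam i j < vbound K.S.n K.S.m lam i (j + 1) := by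
      rw [hv, vbound]
      change _ < _ - crit _ _ _ (j + 2) + lam (j + 2)
      omega
    have hord : (K.eval (f (j + 2))).order =
        (crit K.S.n K.S.m lam (i + 2) - crit K.S.n K.S.m lam (j + 2) : ℕ) := by
      change K.nu (f (j + 2) • ω (j + 2)) = _ at f3
      rw [K.nu_mul, hω.value (j + 2) (by omega), vbound, Nat.cast_add] at f3
      exact WithTop.add_right_cancel (ENat.natCast_ne_top _) f3
    have hnu : ∀ l, K.nu ((f (j + 2) * g l) • ω l) =
        (crit K.S.n K.S.m lam (i + 2) - crit K.S.n K.S.m lam (j + 2) : ℕ) +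
          K.nu (g l • ω l) := fun l => by
      rw [mul_smul, K.nu_mul, hord]
    have hfl : ∀ l, l ≤ j + 1 → (vbound K.S.n K.S.m lam i j : ℕ∞) < K.nu (f l • ω l) :=
      fun l hl => lt_of_lt_of_le (by exact_mod_cast hv') (f2 l (by omega))
    have heq : ∀ l, l ≤ j + 1 → K.nu (g l • ω l) = axis K.S.n K.S.m lam (j + 1) →
        K.nu ((f l + f (j + 2) * g l) • ω l) = vbound K.S.n K.S.m lam i j := by
      intro l hl h
      have h5 : K.nu ((f (j + 2) * g l) • ω l) = vbound K.S.n K.S.m lam i j := by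
        rw [hnu, h, hv, Nat.cast_add]
      rw [add_smul, add_comm, K.nu_add_of_lt, h5]
      rw [h5]
      exact hfl l hl
    have hgt : ∀ l, l ≤ j + 1 → K.nu (g l • ω l) ≠ axis K.S.n K.S.m lam (j + 1) →
        (vbound K.S.n K.S.m lam i j : ℕ∞) < K.nu ((f l + f (j + 2) * g l) • ω l) := by
      intro l hl h
      rw [add_smul]
      refine K.lt_nu_add (hfl l hl) ?_
      rw [hnu, hv, Nat.cast_add]
      exact (ENat.add_lt_add_iff_left (ENat.natCast_ne_top _)).2 (lt_of_le_of_ne (g2 l hl) h.symm)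
    refine ⟨fun l => f l + f (j + 2) * g l, ?_, fun l hl => ?_, heq _ le_rfl g3, k,
      ⟨by omega, heq k (by omega) gk⟩, ?_⟩
    · rw [f1, Finset.sum_range_succ, g1, Finset.smul_sum, ← Finset.sum_add_distrib]
      refine Finset.sum_congr rfl fun l _ => ?_
      rw [add_smul, mul_smul]
    · by_cases h : K.nu (g l • ω l) = axis K.S.n K.S.m lam (j + 1)
      · exact (heq l hl h).ge
      · exact (hgt l hl h).le
    · rintro l ⟨hl, hl'⟩
      by_contra hne
      refine (hgt l (by omega) fun h => hne (huniq l ⟨by omega, h⟩)).ne' hl'
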